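/- **Tree CVRP.** An instance consists of a tree $T=(V,E)$ with $n=|V|$ vertices, a root $r\in V$ (the depot), nonnegative rational edge weights, a set $V'\subseteq V$ of terminals, a positive integer demand $d(v)$ for each $v\in V'$, and a positive integer tour capacity $k$. A tour is a closed walk in $T$ that starts and ends at $r$, together with the amounts of demand that it serves at vertices it goes through; its cost is the total weight of the edges traversed. A feasible solution is a finite collection of tours, each serving a total of at most $k$ units of demand, which together serve exactly the demand $d(v)$ at every terminal $v$ and nothing elsewhere; the cost of the solution is the total cost of its tours and is to be minimized. * In the *unit demand* version, $d(v)=1$ for all $v\in V'$ and $k\le n$ (so each tour visits at most $k$ terminals, and each terminal is visited by one tour). * In the *splittable* version, the demand of a terminal may be served by several tours. * In the *unsplittable* version, $d(v)\le k$ for all $v\in V'$ and the entire demand of each terminal is served by a single tour. For $v\in V$ let $\mathrm{dist}(v)$ be the distance from $r$ to $v$ in $T$. Given $\varepsilon>0$, an instance has *bounded distances* if $$D_{\max}<\left(\frac1\varepsilon\right)^{\frac1\varepsilon-1}\cdot D_{\min},$$ where $D_{\max}$ and $D_{\min}$ are the maximum and the minimum of $\mathrm{dist}(v)$ over the terminals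 $v\in V'$ (if $V'=\emptyset$, the condition counts as satisfied). A *polynomial time $\rho$-approximation algorithm* for a class of instances is a deterministic algorithm that, on every instance of the class, halts within time polynomial in the length of the input (all numbers written in binary) and outputs a feasible solution of cost at most $\rho$ times the minimum; solutions are output as lists of tours with multiplicities. **Theorem.** Let $0<\varepsilon\le\frac12$ and $\rho\ge1$ be real constants. If there is a polynomial time $\rho$-approximation algorithm for the unit demand (resp. splittable, or unsplittable) CVRP on trees with bounded distances, then there is a polynomial time $(1+5\varepsilon)\rho$-approximation algorithm for the unit demand (resp. splittable, or unsplittable) CVRP on trees with general distances. -/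

import Mathlib

/-! ### A programming language with logarithmic cost -/

/-- Data values: natural numbers (stored in binary), closed under forming pairs. -/
inductive Val : Type where
  | num (n : ℕ) : Val
  | pair (a b : Val) : Val

namespace Val

/-- The size of a value, in bits: a number counts with its binary length, and each node
of the pair structure counts one more. -/
def size : Val → ℕ
  | num n => Nat.size n + 1
  | pair a b => a.size + b.size + 1

/-- Lists of values: `num 0` is the empty list and `pair a l` is the list with head `a` and
tail `l`. -/
def ofList : List Val → Val
  | [] => num 0
  | a :: l => pair a (ofList l)

end Val

/-- The elementary operations. -/
inductive Op : Type where
  | ident | fst | snd | isPair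
  | const (n : ℕ)
  | add | sub | mul | div | le

/-- Apply an arithmetic operation to a pair of numbers (and answer `0` on ill-formed data). -/
def Val.arith (f : ℕ → ℕ → ℕ) : Val → Val
  | .pair (.num a) (.num b) => .num (f a b)
  | _ => .num 0

/-- The effect of the elementary operations; truth values are `1` and `0`. -/
def Op.apply : Op → Val → Val
  | .ident, x => x
  | .fst, .pair a _ => a
  | .fst, .num _ => .num 0
  | .snd, .pair _ b => b
  | .snd, .num _ => .num 0
  | .isPair, .pair _ _ => .num 1
  | .isPair, .num _ => .num 0
  | .const n, _ => .num n
  | .add, x => x.arith (fun a b => a + b)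
  | .sub, x => x.arith (fun a b => a - b)
  | .mul, x => x.arith (fun a b => a * b)
  | .div, x => x.arith (fun a b => a / b)
  | .le, x => x.arith (fun a b => if a ≤ b then 1 else 0)

/-- Programs. `seq p q` runs `p` and then `q` on the result of `p`; `both p q` runs `p` and `q`
on the same input and pairs the results; `cond c p q` branches on the result of the test `c`;
`loop c p` is the loop "while `c x` holds, replace `x` by `p x`". -/
inductive Prog : Type where
  | op (o : Op) : Prog
  | seq (p q : Prog) : Prog
  | both (p q : Prog) : Prog
  | cond (c p q : Prog) : Prog
  | loop (c p : Prog) : Prog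

/-- `Runs p x y t`: the program `p` on input `x` halts with output `y`, at total cost `t`.
An elementary operation costs one plus the number of bits of its argument and of its result;
every control step costs one more. Hence the cost of a run is at least the size of every value
that occurs in it, and running times agree with those of multitape Turing machines up to a
polynomial. -/
inductive Runs : Prog → Val → Val → ℕ → Prop where
  | op (o : Op) (x : Val) : Runs (.op o) x (o.apply x) (x.size + (o.apply x).size + 1)
  | seq {p q : Prog} {x y z : Val} {s t : ℕ} :
      Runs p x y s → Runs q y z t → Runs (.seq p q) x z (s + t + 1)
  | both {p q : Prog} {x y z : Val} {s t : ℕ} :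
      Runs p x y s → Runs q x z t → Runs (.both p q) x (.pair y z) (s + t + 1)
  | condTrue {c p q : Prog} {x b y : Val} {s t : ℕ} :
      Runs c x b s → b ≠ .num 0 → Runs p x y t → Runs (.cond c p q) x y (s + t + 1)
  | condFalse {c p q : Prog} {x y : Val} {s t : ℕ} :
      Runs c x (.num 0) s → Runs q x y t → Runs (.cond c p q) x y (s + t + 1)
  | loopDone {c p : Prog} {x : Val} {s : ℕ} :
      Runs c x (.num 0) s → Runs (.loop c p) x x (s + 1)
  | loopStep {c p : Prog} {x b y z : Val} {s t u : ℕ} :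
      Runs c x b s → b ≠ .num 0 → Runs p x y t → Runs (.loop c p) y z u →
      Runs (.loop c p) x z (s + t + u + 1)

/-! ### Vehicle routing on trees -/

/-- A tree on the vertices `0, …, n - 1` with a depot (the root) and nonnegative rational edge
weights. Only the weights of edges of the tree are ever used. -/
structure DepotTree where
  n : ℕ
  graph : SimpleGraph (Fin n)
  isTree : graph.IsTree
  root : Fin n
  weight : Sym2 (Fin n) → ℚ≥0

namespace DepotTree

/-- Total weight of the edges of a walk, counted as often as they are traversed. -/
def walkWeight (T : DepotTree) {u v : Fin T.n} (p : T.graph.Walk u v) : ℚ≥0 :=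
  (p.edges.map T.weight).sum

/-- Distance from the depot to `v`: the weight of the unique path between them. -/
noncomputable def dist (T : DepotTree) (v : Fin T.n) : ℚ≥0 :=
  T.walkWeight (T.isTree.existsUnique_path T.root v).choose

/-- A tour: a closed walk from the depot, together with the amount of demand that it serves at
each vertex. It can serve demand only at the vertices it goes through, and it may go through
a vertex without serving it. -/
structure Tour (T : DepotTree) where
  walk : T.graph.Walk T.root T.root
  load : Fin T.n → ℕ
  load_support : ∀ v, load v ≠ 0 → v ∈ walk.support

/-- A collection of tours, given as a list in which the entry `(m, t)` stands for `m` copies of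
the tour `t`. (Demands are written in binary, so in the splittable case the number of
tours can be exponential in the input length, although few distinct tours suffice.) -/
abbrev Plan (T : DepotTree) : Type := List (ℕ × T.Tour)

/-- Total cost of a collection of tours. -/
def Plan.cost {T : DepotTree} (S : T.Plan) : ℚ≥0 :=
  (S.map fun q => (q.1 : ℚ≥0) * T.walkWeight q.2.walk).sum

/-- Total amount served at `v`. -/
def Plan.served {T : DepotTree} (S : T.Plan) (v : Fin T.n) : ℕ :=
  (S.map fun q => q.1 * q.2.load v).sum

end DepotTree

/-- An instance: a tree with a depot, the demands, and the tour capacity. -/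
structure CVRP where
  tree : DepotTree
  demand : Fin tree.n → ℕ
  capacity : ℕ

/-- The three versions of the problem. -/
inductive Version : Type where
  | unitDemand | splittable | unsplittable

namespace CVRP

/-- The terminals are the vertices with positive demand. -/
def IsTerminal (I : CVRP) (v : Fin I.tree.n) : Prop := 0 < I.demand v

/-- Which data are instances of the three versions. The capacity is always positive. In the unit
demand version every terminal has demand one and the capacity is at most the number of
vertices; in the unsplittable version no demand exceeds the capacity (otherwise there is
no feasible solution). -/
def IsInstance (I : CVRP) : Version → Prop
  | .unitDemand => 0 < I.capacity ∧ I.capacity ≤ I.tree.n ∧ ∀ v, I.IsTerminal v → I.demand v = 1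
  | .splittable => 0 < I.capacity
  | .unsplittable => 0 < I.capacity ∧ ∀ v, I.demand v ≤ I.capacity

/-- Feasible solutions: no tour serves more than the capacity, and every demand is served; in the
unsplittable version each tour serves all of the demand of a vertex or none of it. (With unit
demands each terminal is automatically served by exactly one tour.) -/
structure Feasible (I : CVRP) (ver : Version) (S : I.tree.Plan) : Prop where
  capacity_le : ∀ q ∈ S, ∑ v, q.2.load v ≤ I.capacity
  served_eq : ∀ v, S.served v = I.demand v
  unsplit : ver = .unsplittable → ∀ q ∈ S, ∀ v, q.2.load v = 0 ∨ q.2.load v = I.demand v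

/-- Bounded distances: the largest distance `D_max` from the depot to a terminal and the smallest
one `D_min` satisfy `D_max < (1/ε)^(1/ε - 1) * D_min`. -/
def BoundedDistances (ε : ℝ) (I : CVRP) : Prop :=
  ∀ u v, I.IsTerminal u → I.IsTerminal v →
    (I.tree.dist u : ℝ) < (1 / ε) ^ (1 / ε - 1) * (I.tree.dist v : ℝ)

open Classical in
/-- Entry of the weighted adjacency matrix: numerator and denominator of the weight of an edge,
and the pair `(0, 0)` for vertices that are not adjacent. -/
noncomputable def encodeEntry (T : DepotTree) (u v : Fin T.n) : Val :=
  if T.graph.Adj u v then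
    .pair (.num (T.weight s(u, v)).num) (.num (T.weight s(u, v)).den)
  else .pair (.num 0) (.num 0)

/-- Input format: root, capacity, list of demands, and weighted adjacency matrix, with all numbers
in binary. -/
noncomputable def encode (I : CVRP) : Val :=
  .pair (.num I.tree.root) (.pair (.num I.capacity)
    (.pair (.ofList (List.ofFn fun v => .num (I.demand v)))
      (.ofList (List.ofFn fun u => .ofList (List.ofFn fun v => encodeEntry I.tree u v)))))

/-- Format of a tour: the list of the vertices of the walk, in order, and the list of the
loads. -/
def encodeTour {T : DepotTree} (t : T.Tour) : Val :=
  .pair (.ofList (t.walk.support.map fun v => .num v))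
    (.ofList (List.ofFn fun v => .num (t.load v)))

/-- Output format: the list of the tours with their multiplicities. -/
def encodePlan {T : DepotTree} (S : T.Plan) : Val :=
  .ofList (S.map fun q => .pair (.num q.1) (encodeTour q.2))

end CVRP

/-- There is a polynomial time `ρ`-approximation algorithm for the version `ver` of tree CVRP
restricted to the instances that satisfy `P`: a program that, on every such instance, halts
within a number of steps polynomial in the length of the input and outputs a feasible
solution whose cost is at most `ρ` times the cost of any feasible solution. -/
def HasPolyTimeApprox (ver : Version) (ρ : ℝ) (P : CVRP → Prop) : Prop :=
  ∃ (A : Prog) (p : Polynomial ℕ), ∀ I : CVRP, I.IsInstance ver → P I →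
    ∃ (S : I.tree.Plan) (t : ℕ),
      Runs A I.encode (CVRP.encodePlan S) t ∧ t ≤ p.eval I.encode.size ∧
      I.Feasible ver S ∧
      ∀ S' : I.tree.Plan, I.Feasible ver S' → (S.cost : ℝ) ≤ ρ * (S'.cost : ℝ)

/-!
A tour can be cut at the distances `a * Q ^ j`: for every `j`, one keeps only the terminals at
distance between `a * Q ^ j` and `a * Q ^ (j + 1)` and shortens the walk accordingly. In a tree, a
shortest closed walk through given vertices costs twice the weight of the subtree that they span
with the root (`exists_closedWalk`, `two_mul_hullWeight_le`), so the loss is caused by the edges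
that several of these subtrees share. If all of the vertices are at distance at least `b`, then the
number of edges of their subtree at distance `y` is nondecreasing for `y ≤ b`
(`mul_lowWeight_le`). Hence the weight below `b` is at most `q / (q - 1)` times the weight between
`b / q` and `b`. For `Q = q ^ P`, the intervals from `b / q` to `b` that belong to the `P` shifts
`a, a * q, …, a * q ^ (P - 1)` are disjoint, so that all shifts together lose at most `q / (q - 1)`
times the cost of the tour (`exists_split_tours`), and the best one of them loses at most the
fraction `q / (q - 1) / P`. Suitable constants `q` and `P` with `q ^ P ≤ (1 / ε) ^ (1 / ε - 1)` make
this at most `5 * ε` (`exists_base_shifts`).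

The algorithm computes the distances, solves every group of every shift by the given algorithm for
bounded distances, serves the terminals at distance zero by tours of cost zero, and returns the
cheapest one of the `P` solutions. Its running time is established by closure properties of the
class `PolyTime` of functions on encodable types that have polynomial time programs; the essential
one is that a left fold is in the class if its accumulator stays polynomially bounded
(`PolyTime.foldl`).
-/

/-! ### Polynomial time functions -/

/-- The cost of a run is at least the sizes of its input and of its result. -/
theorem Runs.size_le {p : Prog} {x y : Val} {t : ℕ} (h : Runs p x y t) :
    x.size ≤ t ∧ y.size ≤ t := by
  induction h <;> (try simp only [Val.size]) <;> omega

theorem Polynomial.eval_nat_mono (p : Polynomial ℕ) {m n : ℕ} (h : m ≤ n) :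
    p.eval m ≤ p.eval n := by
  rw [Polynomial.eval_eq_sum, Polynomial.eval_eq_sum]
  exact Finset.sum_le_sum fun i _ => Nat.mul_le_mul_left _ (Nat.pow_le_pow_left h i)

/-- A type whose elements are written as data values. -/
class ValCode (α : Type) where
  enc : α → Val

open ValCode (enc)

instance : ValCode Val := ⟨id⟩
instance : ValCode ℕ := ⟨Val.num⟩
instance : ValCode Bool := ⟨fun b => .num b.toNat⟩
instance {α β : Type} [ValCode α] [ValCode β] : ValCode (α × β) := ⟨fun x => .pair (enc x.1) (enc x.2)⟩
instance {α : Type} [ValCode α] : ValCode (List α) := ⟨fun l => .ofList (l.map enc)⟩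
instance {α : Type} [ValCode α] (P : α → Prop) : ValCode {x // P x} := ⟨fun x => enc x.1⟩

/-- The length in bits of the code of an object. -/
def codeSize {α : Type} [ValCode α] (a : α) : ℕ := (enc a).size

/-- `f` is computed, on codes, by a program whose running time is polynomial in the size of
the input. -/
@[fun_prop]
def PolyTime {α β : Type} [ValCode α] [ValCode β] (f : α → β) : Prop :=
  ∃ (A : Prog) (p : Polynomial ℕ), ∀ a, ∃ t,
    Runs A (enc a) (enc (f a)) t ∧ t ≤ p.eval (codeSize a)

section Size

variable {α β : Type} [ValCode α] [ValCode β]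

theorem codeSize_pair (a : α) (b : β) : codeSize (a, b) = codeSize a + codeSize b + 1 := rfl

theorem codeSize_nil : codeSize ([] : List α) = 1 := rfl

theorem codeSize_cons (a : α) (l : List α) :
    codeSize (a :: l) = codeSize a + codeSize l + 1 := rfl

theorem codeSize_nat (n : ℕ) : codeSize n = n.size + 1 := rfl

theorem codeSize_append (l l' : List α) :
    codeSize (l ++ l') + 1 = codeSize l + codeSize l' := by
  induction l with
  | nil => simp only [List.nil_append, codeSize_nil]; omega
  | cons a l ih => simp only [List.cons_append, codeSize_cons]; omega

theorem codeSize_reverse (l : List α) : codeSize l.reverse = codeSize l := by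
  induction l with
  | nil => rfl
  | cons b l ih =>
    have := codeSize_append l.reverse [b]
    rw [List.reverse_cons, codeSize_cons]
    rw [codeSize_cons, codeSize_nil] at this
    omega

theorem codeSize_pos (a : α) : 0 < codeSize a := by
  unfold codeSize; cases enc a <;> simp [Val.size]

theorem codeSize_le_of_mem {a : α} {l : List α} (h : a ∈ l) : codeSize a ≤ codeSize l := by
  induction l with
  | nil => simp at h
  | cons b l ih =>
    rw [codeSize_cons]
    rcases List.mem_cons.1 h with rfl | h
    · omega
    · have := ih h; omega

theorem length_le_codeSize (l : List α) : l.length ≤ codeSize l := by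
  induction l with
  | nil => simp
  | cons b l ih => rw [codeSize_cons, List.length_cons]; omega

theorem codeSize_le_of_prefix {l l' : List α} (h : l' <+: l) : codeSize l' ≤ codeSize l := by
  obtain ⟨r, rfl⟩ := h
  have := codeSize_append l' r
  have := codeSize_pos r
  omega

/-- A list of at most `m` entries of size at most `c` each. -/
theorem codeSize_list_le {l : List α} {m c : ℕ} (hm : l.length ≤ m)
    (hc : ∀ a ∈ l, codeSize a ≤ c) : codeSize l ≤ m * (c + 1) + 1 := by
  induction l generalizing m with
  | nil => simp [codeSize_nil]
  | cons a l ih =>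
    obtain ⟨m, rfl⟩ : ∃ k, m = k + 1 := ⟨m - 1, by simp at hm; omega⟩
    have h1 := ih (m := m) (by simpa using hm) fun b hb => hc b (by simp [hb])
    have h2 := hc a (by simp)
    rw [codeSize_cons]
    nlinarith

theorem Nat.size_le_self (n : ℕ) : n.size ≤ n := by
  rw [Nat.size_le]; exact Nat.lt_two_pow_self

theorem Nat.size_mul_le (a b : ℕ) : (a * b).size ≤ a.size + b.size := by
  rw [Nat.size_le, pow_add]
  exact Nat.mul_lt_mul'' a.lt_size_self b.lt_size_self

theorem Nat.size_add_le (a b : ℕ) : (a + b).size ≤ max a.size b.size + 1 := by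
  rw [Nat.size_le, pow_succ]
  have h1 := a.lt_size_self.trans_le (Nat.pow_le_pow_right two_pos (le_max_left a.size b.size))
  have h2 := b.lt_size_self.trans_le (Nat.pow_le_pow_right two_pos (le_max_right a.size b.size))
  omega

end Size

namespace PolyTime

variable {α β γ δ : Type} [ValCode α] [ValCode β] [ValCode γ] [ValCode δ]

/-- A running time bounds the size of the result. -/
theorem size_le {f : α → β} (hf : PolyTime f) :
    ∃ p : Polynomial ℕ, ∀ a, codeSize (f a) ≤ p.eval (codeSize a) := by
  obtain ⟨A, p, h⟩ := hf
  refine ⟨p, fun a => ?_⟩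
  obtain ⟨t, h1, h2⟩ := h a
  exact h1.size_le.2.trans h2

/-- Only the codes matter. -/
theorem of_enc_eq {γ : Type} [ValCode γ] {f : α → β} {g : α → γ} (hf : PolyTime f)
    (h : ∀ a, enc (g a) = enc (f a)) : PolyTime g := by
  obtain ⟨A, p, hA⟩ := hf
  exact ⟨A, p, fun a => by rw [h]; exact hA a⟩

/-- A function that is an elementary operation on codes. -/
theorem of_op {f : α → β} (o : Op) (h : ∀ a, enc (f a) = o.apply (enc a)) (p : Polynomial ℕ)
    (hp : ∀ a, codeSize (f a) ≤ p.eval (codeSize a)) : PolyTime f := by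
  refine ⟨.op o, Polynomial.X + p + 1, fun a =>
    ⟨(enc a).size + (o.apply (enc a)).size + 1, by rw [h]; exact .op o (enc a), ?_⟩⟩
  have := hp a
  rw [codeSize, h] at this
  simp only [Polynomial.eval_add, Polynomial.eval_X, Polynomial.eval_one]
  unfold codeSize at *
  omega

theorem of_op_le {f : α → β} (o : Op) (h : ∀ a, enc (f a) = o.apply (enc a)) (k : ℕ)
    (hp : ∀ a, codeSize (f a) ≤ codeSize a + k) : PolyTime f :=
  of_op o h (Polynomial.X + Polynomial.C k) fun a => by simpa using hp a

@[fun_prop]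
theorem id : PolyTime (fun x : α => x) := of_op_le .ident (fun _ => rfl) 0 fun _ => le_rfl

@[fun_prop]
theorem comp {g : β → γ} {f : α → β} (hg : PolyTime g) (hf : PolyTime f) :
    PolyTime (fun x => g (f x)) := by
  obtain ⟨A, p, hA⟩ := hf
  obtain ⟨B, q, hB⟩ := hg
  refine ⟨.seq A B, p + q.comp p + 1, fun a => ?_⟩
  obtain ⟨s, hs, hs'⟩ := hA a
  obtain ⟨t, ht, ht'⟩ := hB (f a)
  refine ⟨_, hs.seq ht, ?_⟩
  have := q.eval_nat_mono (hs.size_le.2.trans hs')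
  simp only [Polynomial.eval_add, Polynomial.eval_comp, Polynomial.eval_one]
  unfold codeSize at *
  omega

@[fun_prop]
theorem prodMk {f : α → β} {g : α → γ} (hf : PolyTime f) (hg : PolyTime g) :
    PolyTime (fun x => (f x, g x)) := by
  obtain ⟨A, p, hA⟩ := hf
  obtain ⟨B, q, hB⟩ := hg
  refine ⟨.both A B, p + q + 1, fun a => ?_⟩
  obtain ⟨s, hs, hs'⟩ := hA a
  obtain ⟨t, ht, ht'⟩ := hB a
  refine ⟨_, hs.both ht, ?_⟩
  simp only [Polynomial.eval_add, Polynomial.eval_one]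
  omega

@[fun_prop]
theorem const (b : β) : PolyTime (fun _ : α => b) := by
  suffices ∀ v : Val, PolyTime (fun _ : α => v) from (this (enc b)).of_enc_eq fun _ => rfl
  intro v
  induction v with
  | num n => exact of_op_le (.const n) (fun _ => rfl) (n.size + 1) fun a => Nat.le_add_left _ _
  | pair a b iha ihb => exact (iha.prodMk ihb).of_enc_eq fun _ => rfl

theorem fst' : PolyTime (Prod.fst : α × β → α) :=
  of_op_le .fst (fun _ => rfl) 0 fun x => by rw [codeSize_pair]; omega

theorem snd' : PolyTime (Prod.snd : α × β → β) :=
  of_op_le .snd (fun _ => rfl) 0 fun x => by rw [codeSize_pair]; omega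

@[fun_prop]
theorem fst {f : α → β × γ} (hf : PolyTime f) : PolyTime (fun x => (f x).1) := fst'.comp hf

@[fun_prop]
theorem snd {f : α → β × γ} (hf : PolyTime f) : PolyTime (fun x => (f x).2) := snd'.comp hf

theorem add' : PolyTime (fun x : ℕ × ℕ => x.1 + x.2) :=
  of_op_le .add (fun _ => rfl) 0 fun x => by
    have := Nat.size_add_le x.1 x.2
    rw [codeSize_pair]; simp only [codeSize_nat]; omega

@[fun_prop]
theorem add {f g : α → ℕ} (hf : PolyTime f) (hg : PolyTime g) : PolyTime (fun x => f x + g x) :=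
  add'.comp (hf.prodMk hg)

theorem mul' : PolyTime (fun x : ℕ × ℕ => x.1 * x.2) :=
  of_op_le .mul (fun _ => rfl) 0 fun x => by
    have := Nat.size_mul_le x.1 x.2
    rw [codeSize_pair]; simp only [codeSize_nat]; omega

@[fun_prop]
theorem mul {f g : α → ℕ} (hf : PolyTime f) (hg : PolyTime g) : PolyTime (fun x => f x * g x) :=
  mul'.comp (hf.prodMk hg)

theorem div' : PolyTime (fun x : ℕ × ℕ => x.1 / x.2) :=
  of_op_le .div (fun _ => rfl) 0 fun x => by
    have := Nat.size_le_size (Nat.div_le_self x.1 x.2)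
    rw [codeSize_pair]; simp only [codeSize_nat]; omega

@[fun_prop]
theorem div {f g : α → ℕ} (hf : PolyTime f) (hg : PolyTime g) : PolyTime (fun x => f x / g x) :=
  div'.comp (hf.prodMk hg)

theorem le' : PolyTime (fun x : ℕ × ℕ => decide (x.1 ≤ x.2)) :=
  of_op_le .le (fun x => by by_cases h : x.1 ≤ x.2 <;> simp [enc, Op.apply, Val.arith, h]) 0
    fun x => by
      have : codeSize (decide (x.1 ≤ x.2)) ≤ 2 := by
        by_cases h : x.1 ≤ x.2 <;> simp [codeSize, enc, h, Val.size]
      have := codeSize_pos x.1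
      have := codeSize_pos x.2
      rw [codeSize_pair]; omega

@[fun_prop]
theorem decide_le {f g : α → ℕ} (hf : PolyTime f) (hg : PolyTime g) :
    PolyTime (fun x => decide (f x ≤ g x)) :=
  le'.comp (hf.prodMk hg)

@[fun_prop]
theorem ite {c : α → Prop} [DecidablePred c] {f g : α → β} (hc : PolyTime fun x => decide (c x))
    (hf : PolyTime f) (hg : PolyTime g) : PolyTime (fun x => if c x then f x else g x) := by
  obtain ⟨C, r, hC⟩ := hc
  obtain ⟨A, p, hA⟩ := hf
  obtain ⟨B, q, hB⟩ := hg
  refine ⟨.cond C A B, r + p + q + 1, fun a => ?_⟩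
  obtain ⟨u, hu, hu'⟩ := hC a
  obtain ⟨s, hs, hs'⟩ := hA a
  obtain ⟨t, ht, ht'⟩ := hB a
  simp only [Polynomial.eval_add, Polynomial.eval_one]
  by_cases h : c a
  · refine ⟨_, .condTrue hu (by simp [enc, h]) (by simpa [h] using hs), by omega⟩
  · refine ⟨_, .condFalse (by simpa [enc, h] using hu) (by simpa [h] using ht), by omega⟩

@[fun_prop]
theorem decide_not {c : α → Prop} [DecidablePred c] (hc : PolyTime fun x => decide (c x)) :
    PolyTime (fun x => decide (¬ c x)) :=
  (hc.ite (const false) (const true)).of_enc_eq fun a => by by_cases h : c a <;> simp [h]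

@[fun_prop]
theorem decide_and {c d : α → Prop} [DecidablePred c] [DecidablePred d]
    (hc : PolyTime fun x => decide (c x)) (hd : PolyTime fun x => decide (d x)) :
    PolyTime (fun x => decide (c x ∧ d x)) :=
  (hc.ite hd (const false)).of_enc_eq fun a => by by_cases h : c a <;> simp [h]

@[fun_prop]
theorem decide_eq {f g : α → ℕ} (hf : PolyTime f) (hg : PolyTime g) :
    PolyTime (fun x => decide (f x = g x)) :=
  ((hf.decide_le hg).decide_and (hg.decide_le hf)).of_enc_eq fun a => by
    simp only [le_antisymm_iff]

@[fun_prop]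
theorem decide_lt {f g : α → ℕ} (hf : PolyTime f) (hg : PolyTime g) :
    PolyTime (fun x => decide (f x < g x)) :=
  (hg.decide_le hf).decide_not.of_enc_eq fun a => by simp only [not_le]

@[fun_prop]
theorem cons {f : α → β} {g : α → List β} (hf : PolyTime f) (hg : PolyTime g) :
    PolyTime (fun x => f x :: g x) :=
  (hf.prodMk hg).of_enc_eq fun _ => rfl

theorem tail' : PolyTime (List.tail : List β → List β) :=
  of_op_le .snd (fun l => by cases l <;> rfl) 0 fun l => by
    cases l
    · rfl
    · rw [List.tail_cons, codeSize_cons]; omega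

@[fun_prop]
theorem tail {f : α → List β} (hf : PolyTime f) : PolyTime (fun x => (f x).tail) :=
  tail'.comp hf

/-- The head of a list, for a default value whose code is the number `0`. -/
theorem headD {f : α → List β} (d : β) (hd : enc d = .num 0) (hf : PolyTime f) :
    PolyTime (fun x => (f x).headD d) :=
  have : PolyTime (fun l : List β => l.headD d) :=
    of_op_le .fst (fun l => by cases l; exacts [hd, rfl]) 0 fun l => by
      cases l
      · rw [List.headD_nil, codeSize, hd]; rfl
      · rw [List.headD_cons, codeSize_cons]; omega
  this.comp hf

theorem not_isEmpty {f : α → List β} (hf : PolyTime f) : PolyTime (fun x => !(f x).isEmpty) :=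
  have : PolyTime (fun l : List β => !l.isEmpty) :=
    of_op_le .isPair (fun l => by cases l <;> rfl) 1 fun l => by
      have := codeSize_pos l
      have : codeSize (!l.isEmpty) ≤ 2 := by cases l <;> simp [codeSize, enc, Val.size]
      omega
  this.comp hf

@[fun_prop]
theorem decide_eq_nil {f : α → List β} [DecidablePred fun x => f x = []] (hf : PolyTime f) :
    PolyTime (fun x => decide (f x = [])) := by
  refine (decide_not (c := fun x => (!(f x).isEmpty) = true) ?_).of_enc_eq fun x => ?_
  · exact hf.not_isEmpty.of_enc_eq fun x => congrArg enc Bool.decide_eq_true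
  · congr 1; simp

end PolyTime

/-! ### Loops over lists -/

/-- A loop through `v 0, v 1, …, v k` in which the test and the body together never take more
than `T` steps. -/
theorem Runs.loop_iterate {c p : Prog} {T : ℕ} (k : ℕ) (v : ℕ → Val)
    (h : ∀ i < k, ∃ b s t, Runs c (v i) b s ∧ b ≠ .num 0 ∧ Runs p (v i) (v (i + 1)) t ∧
      s + t + 1 ≤ T)
    (hk : ∃ s, Runs c (v k) (.num 0) s ∧ s + 1 ≤ T) :
    ∃ t, Runs (.loop c p) (v 0) (v k) t ∧ t ≤ (k + 1) * T := by
  induction k generalizing v with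
  | zero =>
    obtain ⟨s, hs, hT⟩ := hk
    exact ⟨_, .loopDone hs, by omega⟩
  | succ k ih =>
    obtain ⟨b, s, t, hs, hb, ht, hT⟩ := h 0 (by omega)
    obtain ⟨u, hu, hu'⟩ := ih (fun i => v (i + 1)) (fun i hi => h (i + 1) (by omega)) hk
    refine ⟨_, .loopStep hs hb ht hu, ?_⟩
    rw [add_mul (k + 1), one_mul]
    omega

namespace PolyTime

/-- One step of the loop that computes a left fold: the state consists of a parameter, the
accumulator, and the list of the entries that have not been used. -/
def foldStep {α β δ : Type} (s : α → β → δ → β) (x : α × β × List δ) : α × β × List δ :=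
  match x.2.2 with
  | [] => x
  | d :: l => (x.1, s x.1 x.2.1 d, l)

theorem foldStep_iterate {α β δ : Type} (s : α → β → δ → β) (a : α) (b : β) (l : List δ) (j : ℕ) :
    (foldStep s)^[j] (a, b, l) = (a, (l.take j).foldl (s a) b, l.drop j) := by
  induction j generalizing b l with
  | zero => simp
  | succ j ih =>
    rw [Function.iterate_succ_apply]
    cases l with
    | nil => simpa [foldStep] using ih b []
    | cons d l => simp [foldStep, ih]

theorem foldl_cons_eq {β γ : Type} (g : β → γ) (l : List β) (l' : List γ) :
    l.foldl (fun acc b => g b :: acc) l' = (l.map g).reverse ++ l' := by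
  induction l generalizing l' with
  | nil => simp
  | cons b l ih => simp [ih]

variable {α β γ δ : Type} [ValCode α] [ValCode β] [ValCode γ] [ValCode δ]

/-- A computation that repeats a polynomial time step `g` while the polynomial time test `c` holds
takes polynomial time if the number of steps and the sizes of all states are polynomially
bounded. The step only has to be computed correctly on the states in which the test holds. -/
theorem iterate {σ : Type} [ValCode σ] {c : σ → Bool} {C : Prog} {r : Polynomial ℕ}
    (hc : ∀ x, ∃ t, Runs C (enc x) (enc (c x)) t ∧ t ≤ r.eval (codeSize x))
    {S : Prog} {p : Polynomial ℕ} {g : σ → σ}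
    (hg : ∀ x, c x = true → ∃ t, Runs S (enc x) (enc (g x)) t ∧ t ≤ p.eval (codeSize x))
    {i : α → σ} (hi : PolyTime i) (k : α → ℕ) (K B : Polynomial ℕ)
    (hk : ∀ a, k a ≤ K.eval (codeSize a))
    (hB : ∀ a, ∀ j ≤ k a, codeSize (g^[j] (i a)) ≤ B.eval (codeSize a))
    (hlt : ∀ a, ∀ j < k a, c (g^[j] (i a)) = true) (hend : ∀ a, c (g^[k a] (i a)) = false) :
    PolyTime fun a => g^[k a] (i a) := by
  obtain ⟨I, q, hI⟩ := hi
  refine ⟨.seq I (.loop C S), q + (K + 1) * (r.comp B + p.comp B + 1) + 1, fun a => ?_⟩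
  obtain ⟨s, hs, hs'⟩ := hI a
  obtain ⟨t, ht, ht'⟩ := Runs.loop_iterate (c := C) (p := S)
    (T := (r.comp B + p.comp B + 1).eval (codeSize a)) (k a) (fun j => enc (g^[j] (i a)))
    (fun j hj => by
      obtain ⟨u, hu, hu'⟩ := hc (g^[j] (i a))
      obtain ⟨w, hw, hw'⟩ := hg (g^[j] (i a)) (hlt a j hj)
      refine ⟨_, u, w, hu, by simp [hlt a j hj, enc], by rwa [Function.iterate_succ_apply'], ?_⟩
      have h1 := r.eval_nat_mono (hB a j hj.le)
      have h2 := p.eval_nat_mono (hB a j hj.le)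
      simp only [Polynomial.eval_add, Polynomial.eval_comp, Polynomial.eval_one]
      omega)
    (by
      obtain ⟨u, hu, hu'⟩ := hc (g^[k a] (i a))
      refine ⟨u, by simpa [hend a, enc] using hu, ?_⟩
      have h1 := r.eval_nat_mono (hB a _ le_rfl)
      simp only [Polynomial.eval_add, Polynomial.eval_comp, Polynomial.eval_one]
      omega)
  refine ⟨_, hs.seq ht, ?_⟩
  have := ht'.trans (Nat.mul_le_mul_right _ (Nat.add_le_add_right (hk a) 1))
  simp only [Polynomial.eval_add, Polynomial.eval_mul, Polynomial.eval_one] at this ⊢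
  omega

/-- A left fold takes polynomial time if the accumulator stays polynomially bounded. -/
theorem foldl {s : α → β → δ → β} {i : α → β} {l : α → List δ}
    (hs : PolyTime fun p : α × β × δ => s p.1 p.2.1 p.2.2) (hi : PolyTime i) (hl : PolyTime l)
    (B : Polynomial ℕ)
    (hB : ∀ a, ∀ l', l' <+: l a → codeSize (l'.foldl (s a) (i a)) ≤ B.eval (codeSize a)) :
    PolyTime fun a => (l a).foldl (s a) (i a) := by
  obtain ⟨L, hL⟩ := hl.size_le
  -- the code of the triple (parameter, accumulator, first entry), read off from the code of a state
  have hR : PolyTime fun v : Val => Val.pair (Op.fst.apply v)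
      (.pair (Op.fst.apply (Op.snd.apply v)) (Op.fst.apply (Op.snd.apply (Op.snd.apply v)))) := by
    have h1 : PolyTime Op.fst.apply := of_op_le .fst (fun _ => rfl) 0 fun v => by
      cases v <;> simp only [codeSize, enc, Op.apply, Val.size, _root_.id, Nat.size_zero] <;> omega
    have h2 : PolyTime Op.snd.apply := of_op_le .snd (fun _ => rfl) 0 fun v => by
      cases v <;> simp only [codeSize, enc, Op.apply, Val.size, _root_.id, Nat.size_zero] <;> omega
    exact (h1.prodMk ((h1.comp h2).prodMk (h1.comp (h2.comp h2)))).of_enc_eq fun _ => rfl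
  obtain ⟨R, q, hR⟩ := hR
  obtain ⟨S, p, hS⟩ := hs
  obtain ⟨F, f, hF⟩ : PolyTime fun x : α × β × List δ => x.1 := by fun_prop
  obtain ⟨G, g, hG⟩ : PolyTime fun x : α × β × List δ => x.2.2.tail := by fun_prop
  obtain ⟨C, r, hC⟩ : PolyTime fun x : α × β × List δ => !x.2.2.isEmpty :=
    not_isEmpty (by fun_prop)
  have key := iterate (α := α) (σ := α × β × List δ) hC (g := foldStep s)
    (S := .both F (.both (.seq R S) G)) (p := f + (q + p.comp q + 1 + g + 1) + 1)
    (fun x hx => by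
      obtain ⟨a, b, _ | ⟨d, l⟩⟩ := x
      · simp at hx
      obtain ⟨t1, h1, h1'⟩ := hF (a, b, d :: l)
      obtain ⟨t2, h2, h2'⟩ := hG (a, b, d :: l)
      obtain ⟨t3, h3, h3'⟩ := hR (enc (a, b, d :: l))
      obtain ⟨t4, h4, h4'⟩ := hS (a, b, d)
      refine ⟨_, h1.both ((Runs.seq h3 h4).both h2), ?_⟩
      have := h3.size_le.2
      have := p.eval_nat_mono (h3.size_le.2.trans h3')
      simp only [Polynomial.eval_add, Polynomial.eval_comp, Polynomial.eval_one]
      change t4 ≤ p.eval (Val.size (enc (a, b, d))) at h4'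
      change t3 ≤ q.eval (codeSize (a, b, d :: l)) at h3'
      change p.eval (Val.size (enc (a, b, d))) ≤ p.eval (q.eval (codeSize (a, b, d :: l))) at this
      omega)
    (i := fun a => (a, i a, l a)) (by fun_prop) (fun a => (l a).length) L
    -- the three terms bound the parameter, the accumulator, and the rest of the list
    (Polynomial.X + B + L + 2)
    (fun a => (length_le_codeSize _).trans (hL a))
    (fun a j _ => by
      have h1 := hB a _ (List.take_prefix j (l a))
      have h2 : codeSize ((l a).drop j) ≤ codeSize (l a) := by
        have := codeSize_append ((l a).take j) ((l a).drop j)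
        have := codeSize_pos ((l a).take j)
        rw [List.take_append_drop] at *
        omega
      have h3 := hL a
      simp only [foldStep_iterate, codeSize_pair, Polynomial.eval_add, Polynomial.eval_X,
        Polynomial.eval_ofNat]
      omega)
    (fun a j hj => by simp [foldStep_iterate, hj])
    (fun a => by simp [foldStep_iterate])
  simp only [foldStep_iterate, List.take_length] at key
  exact key.snd.fst

@[fun_prop]
theorem reverse {l : α → List β} (hl : PolyTime l) : PolyTime fun a => (l a).reverse := by
  obtain ⟨L, hL⟩ := hl.size_le
  have key (l l' : List β) : l.foldl (fun acc b => b :: acc) l' = l.reverse ++ l' := by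
    simp
  have := foldl (α := α) (β := List β) (s := fun _ acc b => b :: acc) (i := fun _ => []) (by fun_prop)
    (by fun_prop) hl L fun a l' h => by
      rw [key, List.append_nil, codeSize_reverse]; exact (codeSize_le_of_prefix h).trans (hL a)
  simpa only [key, List.append_nil] using this

@[fun_prop]
theorem append {l l' : α → List β} (hl : PolyTime l) (hl' : PolyTime l') :
    PolyTime fun a => l a ++ l' a := by
  obtain ⟨L, hL⟩ := hl.reverse.size_le
  obtain ⟨L', hL'⟩ := hl'.size_le
  have key (l l' : List β) : l.foldl (fun acc b => b :: acc) l' = l.reverse ++ l' := by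
    simp
  have := foldl (α := α) (β := List β) (s := fun _ acc b => b :: acc) (by fun_prop)
    hl' hl.reverse (L + L' + 1) fun a m h => by
      have h1 := (codeSize_le_of_prefix h).trans (hL a)
      have h2 := hL' a
      have h3 := codeSize_append m.reverse (l' a)
      have h4 := codeSize_reverse m
      rw [key]
      simp only [Polynomial.eval_add, Polynomial.eval_one]
      omega
  simpa only [key, List.reverse_reverse] using this

theorem map {g : α → β → γ} {l : α → List β} (hg : PolyTime fun p : α × β => g p.1 p.2)
    (hl : PolyTime l) : PolyTime fun a => (l a).map (g a) := by
  obtain ⟨L, hL⟩ := hl.size_le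
  obtain ⟨G, hG⟩ := hg.size_le
  have := foldl (s := fun a acc b => g a b :: acc) (i := fun _ : α => ([] : List γ))
    (l := l) (cons (hg.comp (f := fun p : α × List γ × β => (p.1, p.2.2)) (by fun_prop)) (by fun_prop)) (by fun_prop) hl (L * (G.comp (Polynomial.X + L + 1) + 1) + 1)
    fun a l' h => by
      rw [foldl_cons_eq, List.append_nil]
      simp only [Polynomial.eval_add, Polynomial.eval_mul, Polynomial.eval_comp,
        Polynomial.eval_one, Polynomial.eval_X]
      refine codeSize_list_le ?_ ?_
      · rw [List.length_reverse, List.length_map]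
        exact h.length_le.trans ((length_le_codeSize _).trans (hL a))
      · intro c hc
        obtain ⟨b, hb, rfl⟩ := List.mem_map.1 (List.mem_reverse.1 hc)
        refine (hG (a, b)).trans (G.eval_nat_mono ?_)
        have := (codeSize_le_of_mem (h.subset hb)).trans (hL a)
        rw [codeSize_pair]
        omega
  have := this.reverse
  simpa only [foldl_cons_eq, List.append_nil, List.reverse_reverse] using this

@[fun_prop]
theorem flatten {l : α → List (List β)} (hl : PolyTime l) : PolyTime fun a => (l a).flatten := by
  obtain ⟨L, hL⟩ := hl.size_le
  have key : ∀ (l : List (List β)) (l' : List β),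
      l.foldl (fun acc b => acc ++ b) l' = l' ++ l.flatten := fun l => by
    induction l with
    | nil => simp
    | cons b l ih => intro l'; simp [ih]
  have hf : ∀ l : List (List β), codeSize l.flatten ≤ codeSize l := fun l => by
    induction l with
    | nil => rfl
    | cons b l ih =>
      have := codeSize_append b l.flatten
      rw [List.flatten_cons, codeSize_cons]
      omega
  have := foldl (α := α) (s := fun _ acc b => acc ++ b) (i := fun _ => ([] : List β))
    (by fun_prop) (by fun_prop) hl L fun a l' h => by
      rw [key, List.nil_append]
      exact (hf _).trans ((codeSize_le_of_prefix h).trans (hL a))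
  simpa only [key, List.nil_append] using this

@[fun_prop]
theorem range_length {l : α → List β} (hl : PolyTime l) :
    PolyTime fun a => List.range (l a).length := by
  obtain ⟨L, hL⟩ := hl.size_le
  have key : ∀ l : List β, l.foldl (fun (acc : ℕ × List ℕ) _ => (acc.1 + 1, acc.1 :: acc.2)) (0, []) =
      (l.length, (List.range l.length).reverse) := fun l => by
    induction l using List.reverseRecOn with
    | nil => simp
    | append_singleton l b ih => simp [ih, List.range_succ]
  have := foldl (α := α) (s := fun _ (acc : ℕ × List ℕ) (_ : β) => (acc.1 + 1, acc.1 :: acc.2))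
    (i := fun _ => (0, [])) (by fun_prop) (by fun_prop) hl ((L + 1) + (L * (L + 1 + 1) + 1) + 1)
    fun a l' h => by
      have hlen := (length_le_codeSize l').trans ((codeSize_le_of_prefix h).trans (hL a))
      rw [key, codeSize_pair, codeSize_nat]
      have h1 := Nat.size_le_self l'.length
      have h2 : codeSize (List.range l'.length).reverse ≤
          L.eval (codeSize a) * (L.eval (codeSize a) + 1 + 1) + 1 := by
        refine codeSize_list_le (by simpa using hlen) fun n hn => ?_
        have := Nat.size_le_self n
        rw [codeSize_nat]
        simp at hn
        omega
      simp only [Polynomial.eval_add, Polynomial.eval_mul, Polynomial.eval_one]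
      omega
  have := this.snd.reverse
  simpa only [key, List.reverse_reverse] using this

@[fun_prop]
theorem getD {l : α → List β} {i : α → ℕ} (d : β) (hl : PolyTime l) (hi : PolyTime i) :
    PolyTime fun a => (l a).getD (i a) d := by
  obtain ⟨L, hL⟩ := hl.size_le
  have key : ∀ i, ∀ l : List β,
      l.foldl (fun (acc : ℕ × β) b => (acc.1 + 1, if acc.1 = i then b else acc.2)) (0, d) =
      (l.length, l.getD i d) := fun i l => by
    induction l using List.reverseRecOn with
    | nil => simp
    | append_singleton l b ih =>
      rw [List.foldl_append, ih]
      rcases lt_trichotomy l.length i with h | h | h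
      · simp [List.getD, h.ne, h, h.le]
      · subst h; simp [List.getD]
      · simp [List.getD, h.ne', List.getElem?_append_left h]
  have := foldl (α := α) (s := fun a (acc : ℕ × β) b => (acc.1 + 1, if acc.1 = i a then b else acc.2))
    (i := fun _ => (0, d)) (by fun_prop) (by fun_prop) hl ((L + 1) + (L + Polynomial.C (codeSize d)) + 1)
    fun a l' h => by
      have hlen := (length_le_codeSize l').trans ((codeSize_le_of_prefix h).trans (hL a))
      have h1 := Nat.size_le_self l'.length
      have h2 : codeSize (l'.getD (i a) d) ≤ L.eval (codeSize a) + codeSize d := by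
        rw [List.getD]
        cases hx : l'[i a]? with
        | none => simp
        | some b =>
          have := (codeSize_le_of_mem (h.subset (List.mem_of_getElem? hx))).trans (hL a)
          simp only [Option.getD_some]; omega
      rw [key, codeSize_pair, codeSize_nat]
      simp only [Polynomial.eval_add, Polynomial.eval_one, Polynomial.eval_C]
      omega
  simpa only [key] using this.snd

/-- The binary length of a number, in unary. -/
theorem replicate_size {n : α → ℕ} (hn : PolyTime n) :
    PolyTime fun a => List.replicate (n a).size 0 := by
  obtain ⟨N, hN⟩ := hn.size_le
  let g : ℕ × List ℕ → ℕ × List ℕ := fun x => (x.1 / 2, 0 :: x.2)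
  have hg : ∀ n j, g^[j] (n, []) = (n / 2 ^ j, List.replicate j 0) := fun n j => by
    induction j with
    | zero => simp
    | succ j ih => rw [Function.iterate_succ_apply', ih]; simp [g, Nat.div_div_eq_div_mul, pow_succ,
        List.replicate_succ]
  obtain ⟨C, r, hC⟩ : PolyTime fun x : ℕ × List ℕ => decide (0 < x.1) := by fun_prop
  obtain ⟨S, p, hS⟩ : PolyTime g := by fun_prop
  have := iterate (σ := ℕ × List ℕ) (g := g) hC (fun x _ => hS x)
    (i := fun a => (n a, [])) (by fun_prop) (fun a => (n a).size) N (N + (N * (1 + 1) + 1) + 1)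
    (fun a => by have := hN a; rw [codeSize_nat] at this; omega)
    (fun a j hj => by
      have h1 := hN a
      rw [codeSize_nat] at h1
      have h2 := Nat.size_le_size (Nat.div_le_self (n a) (2 ^ j))
      have h3 : codeSize (List.replicate j 0) ≤ N.eval (codeSize a) * (1 + 1) + 1 :=
        codeSize_list_le (by simp; omega) fun b hb => by
          rw [List.eq_of_mem_replicate hb]; rfl
      rw [hg, codeSize_pair, codeSize_nat]
      simp only [Polynomial.eval_add, Polynomial.eval_mul, Polynomial.eval_one]
      omega)
    (fun a j hj => by
      rw [hg, decide_eq_true_eq]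
      exact Nat.div_pos (Nat.lt_size.1 hj) (by positivity))
    (fun a => by
      rw [hg, decide_eq_false_iff_not, not_lt, Nat.div_eq_of_lt (Nat.lt_size_self _)])
  simp only [hg] at this
  exact this.snd

end PolyTime

/-! ### Arithmetic of fractions and of weighted matrices -/

/-- The sum of two fractions, which are given by numerator and denominator and not reduced. -/
def fracAdd (x y : ℕ × ℕ) : ℕ × ℕ := (x.1 * y.2 + y.1 * x.2, x.2 * y.2)

/-- The sum of a list of fractions, not reduced. -/
def fracSum (l : List (ℕ × ℕ)) : ℕ × ℕ := l.foldl fracAdd (0, 1)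

/-- Entry of a matrix of fractions; `(0, 0)` outside of the matrix. -/
def matEntry (M : List (List (ℕ × ℕ))) (u v : ℕ) : ℕ × ℕ := (M.getD u []).getD v (0, 0)

/-- The weight of a walk that is given by the list of its vertices, for the matrix `M` of edge
weights. The accumulator holds the last vertex and the weight of the walk up to there. -/
def walkFrac (M : List (List (ℕ × ℕ))) (l : List ℕ) : ℕ × ℕ :=
  (l.tail.foldl (fun (s : ℕ × ℕ × ℕ) v => (v, fracAdd s.2 (matEntry M s.1 v)))
    (l.headD 0, (0, 1))).2

/-- The product of `(a + 1) * b` over a list of fractions `a / b`. Every nonzero one of them lies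
between the reciprocal of this number and the number itself. -/
def fracHeight (l : List (ℕ × ℕ)) : ℕ := l.foldl (fun m d => m * ((d.1 + 1) * d.2)) 1

/-- The first terms of the geometric sequence `a, a * Q, a * Q ^ 2, …`, as many as the list `l` has
entries, in the opposite order. -/
def geomList (a Q : ℕ) (l : List ℕ) : List ℕ :=
  (l.foldl (fun (s : ℕ × List ℕ) _ => (s.1 * Q, s.1 :: s.2)) (a, [])).2

/-- The larger one of the binary lengths of numerator and denominator. -/
def fracBits (x : ℕ × ℕ) : ℕ := max x.1.size x.2.size

/-- Lengths grow additively, so sums of many fractions stay polynomially bounded although they are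
not reduced. -/
theorem fracBits_add_le (x y : ℕ × ℕ) :
    fracBits (fracAdd x y) ≤ fracBits x + fracBits y + 1 := by
  have h1 := Nat.size_add_le (x.1 * y.2) (y.1 * x.2)
  have h2 := Nat.size_mul_le x.1 y.2
  have h3 := Nat.size_mul_le y.1 x.2
  have h4 := Nat.size_mul_le x.2 y.2
  simp only [fracBits, fracAdd]
  omega

theorem fracBits_lt_codeSize (x : ℕ × ℕ) : fracBits x < codeSize x := by
  rw [codeSize_pair, codeSize_nat, codeSize_nat]
  simp only [fracBits]; omega

theorem codeSize_le_fracBits (x : ℕ × ℕ) : codeSize x ≤ 2 * fracBits x + 3 := by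
  rw [codeSize_pair, codeSize_nat, codeSize_nat]
  simp only [fracBits]; omega

theorem fracBits_matEntry_lt (M : List (List (ℕ × ℕ))) (u v : ℕ) :
    fracBits (matEntry M u v) < codeSize M := by
  have h0 : fracBits (0, 0) < codeSize M := by simpa [fracBits] using codeSize_pos M
  rw [matEntry, List.getD, List.getD]
  cases h : M[u]? with
  | none => simpa using h0
  | some r =>
    rw [Option.getD_some]
    cases h' : r[v]? with
    | none => simpa using h0
    | some x =>
      exact (fracBits_lt_codeSize x).trans_le ((codeSize_le_of_mem (List.mem_of_getElem? h')).trans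
        (codeSize_le_of_mem (List.mem_of_getElem? h)))

theorem foldl_geomList (a Q : ℕ) (l : List ℕ) :
    l.foldl (fun (s : ℕ × List ℕ) _ => (s.1 * Q, s.1 :: s.2)) (a, []) =
      (a * Q ^ l.length, ((List.range l.length).map (a * Q ^ ·)).reverse) := by
  induction l using List.reverseRecOn with
  | nil => simp
  | append_singleton l x ih => simp [ih, List.range_succ, pow_succ, mul_assoc]

theorem Nat.size_pow_le (Q k : ℕ) : (Q ^ k).size ≤ k * Q.size + 1 := by
  induction k with
  | zero => simp
  | succ k ih =>
    have := Nat.size_mul_le (Q ^ k) Q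
    rw [pow_succ, add_mul, one_mul]; omega

namespace PolyTime

variable {α β : Type} [ValCode α] [ValCode β]

@[fun_prop]
theorem fracAdd {f g : α → ℕ × ℕ} (hf : PolyTime f) (hg : PolyTime g) :
    PolyTime fun a => fracAdd (f a) (g a) := by
  unfold _root_.fracAdd; fun_prop

@[fun_prop]
theorem fracSum {l : α → List (ℕ × ℕ)} (hl : PolyTime l) : PolyTime fun a => fracSum (l a) := by
  obtain ⟨L, hL⟩ := hl.size_le
  refine foldl (by fun_prop) (by fun_prop) hl (2 * L + 3) fun a l' h => ?_
  have key : fracBits (l'.foldl _root_.fracAdd (0, 1)) ≤ codeSize l' := by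
    clear h
    induction l' using List.reverseRecOn with
    | nil => simp [fracBits, codeSize_nil]
    | append_singleton l x ih =>
      have h1 := fracBits_add_le (l.foldl _root_.fracAdd (0, 1)) x
      have h2 := fracBits_lt_codeSize x
      have h3 := codeSize_append l [x]
      rw [codeSize_cons, codeSize_nil] at h3
      rw [List.foldl_append, List.foldl_cons, List.foldl_nil]
      omega
  refine (codeSize_le_fracBits _).trans ?_
  have := (codeSize_le_of_prefix h).trans (hL a)
  simp only [Polynomial.eval_add, Polynomial.eval_mul, Polynomial.eval_ofNat]
  omega

@[fun_prop]
theorem matEntry {M : α → List (List (ℕ × ℕ))} {u v : α → ℕ} (hM : PolyTime M) (hu : PolyTime u)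
    (hv : PolyTime v) : PolyTime fun a => matEntry (M a) (u a) (v a) := by
  unfold _root_.matEntry; fun_prop

@[fun_prop]
theorem walkFrac {M : α → List (List (ℕ × ℕ))} {l : α → List ℕ} (hM : PolyTime M)
    (hl : PolyTime l) : PolyTime fun a => walkFrac (M a) (l a) := by
  obtain ⟨L, hL⟩ := hl.size_le
  obtain ⟨K, hK⟩ := hM.size_le
  refine snd (foldl (s := fun a (s : ℕ × ℕ × ℕ) v => (v, _root_.fracAdd s.2
    (_root_.matEntry (M a) s.1 v))) (i := fun a => ((l a).headD 0, (0, 1))) (by fun_prop)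
    ((headD 0 rfl hl).prodMk (const _)) hl.tail (L + 1 + (2 * (L * K + 1) + 3)) fun a l' h => ?_)
  have key : ∀ s : ℕ × ℕ × ℕ, s = l'.foldl (fun (s : ℕ × ℕ × ℕ) v => (v, _root_.fracAdd s.2
      (_root_.matEntry (M a) s.1 v))) ((l a).headD 0, (0, 1)) →
      codeSize s.1 ≤ codeSize (l a) ∧ fracBits s.2 ≤ l'.length * codeSize (M a) + 1 := by
    induction l' using List.reverseRecOn with
    | nil =>
      rintro s rfl
      refine ⟨?_, by simp [fracBits]⟩
      cases h : l a with
      | nil => simp [codeSize_nil, codeSize_nat]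
      | cons b m => rw [codeSize_cons]; simp only [List.foldl_nil, List.headD_cons]; omega
    | append_singleton m x ih =>
      rintro s rfl
      rw [List.foldl_append, List.foldl_cons, List.foldl_nil]
      have h0 := (List.prefix_append m [x]).trans h
      have h1 := (ih h0 _ rfl).2
      refine ⟨codeSize_le_of_mem (List.mem_of_mem_tail (h.subset (by simp))), ?_⟩
      refine (fracBits_add_le _ _).trans ?_
      have h2 := fracBits_matEntry_lt (M a) (m.foldl (fun (s : ℕ × ℕ × ℕ) v => (v, _root_.fracAdd s.2
        (_root_.matEntry (M a) s.1 v))) ((l a).headD 0, (0, 1))).1 x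
      rw [List.length_append, List.length_singleton, add_mul, one_mul]
      omega
  obtain ⟨h1, h2⟩ := key _ rfl
  have h3 := codeSize_le_fracBits (l'.foldl (fun (s : ℕ × ℕ × ℕ) v => (v, _root_.fracAdd s.2
      (_root_.matEntry (M a) s.1 v))) ((l a).headD 0, (0, 1))).2
  have h4 : l'.length ≤ codeSize (l a) :=
    (h.length_le.trans (by simp)).trans (length_le_codeSize _)
  have h5 := Nat.mul_le_mul (h4.trans (hL a)) (hK a)
  have h6 := hL a
  refine (codeSize_pair _ _).trans_le ?_
  simp only [Polynomial.eval_add, Polynomial.eval_mul, Polynomial.eval_ofNat, Polynomial.eval_one]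
  omega

@[fun_prop]
theorem fracHeight {l : α → List (ℕ × ℕ)} (hl : PolyTime l) :
    PolyTime fun a => fracHeight (l a) := by
  obtain ⟨L, hL⟩ := hl.size_le
  refine foldl (s := fun _ (m : ℕ) (d : ℕ × ℕ) => m * ((d.1 + 1) * d.2)) (by fun_prop) (by fun_prop)
    hl (L + 1) fun a l' h => ?_
  have key : (l'.foldl (fun (m : ℕ) (d : ℕ × ℕ) => m * ((d.1 + 1) * d.2)) 1).size ≤ codeSize l' := by
    clear h
    induction l' using List.reverseRecOn with
    | nil => simp [codeSize_nil]
    | append_singleton l x ih =>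
      have h3 := codeSize_append l [x]
      rw [codeSize_cons, codeSize_nil, codeSize_pair, codeSize_nat, codeSize_nat] at h3
      rw [List.foldl_append, List.foldl_cons, List.foldl_nil]
      have h4 := Nat.size_mul_le (l.foldl (fun (m : ℕ) (d : ℕ × ℕ) => m * ((d.1 + 1) * d.2)) 1)
        ((x.1 + 1) * x.2)
      have h5 := Nat.size_mul_le (x.1 + 1) x.2
      have h6 := Nat.size_add_le x.1 1
      have h7 : (1 : ℕ).size = 1 := Nat.size_one
      omega
  have := (codeSize_le_of_prefix h).trans (hL a)
  rw [codeSize_nat]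
  simp only [Polynomial.eval_add, Polynomial.eval_one]
  omega

@[fun_prop]
theorem geomList (b Q : ℕ) {l : α → List ℕ} (hl : PolyTime l) :
    PolyTime fun a => geomList b Q (l a) := by
  obtain ⟨L, hL⟩ := hl.size_le
  let T : Polynomial ℕ := Polynomial.C b.size + (L * Polynomial.C Q.size + 1)
  refine snd (foldl (s := fun _ (s : ℕ × List ℕ) (_ : ℕ) => (s.1 * Q, s.1 :: s.2)) (by fun_prop)
    (by fun_prop) hl (T + 1 + (L * (T + 1 + 1) + 1) + 1) fun a l' h => ?_)
  have h1 := (length_le_codeSize l').trans ((codeSize_le_of_prefix h).trans (hL a))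
  have key : ∀ k ≤ l'.length, codeSize (b * Q ^ k) ≤ T.eval (codeSize a) + 1 := fun k hk => by
    have h2 := Nat.size_mul_le b (Q ^ k)
    have h3 := Nat.size_pow_le Q k
    have h4 := Nat.mul_le_mul_right Q.size (hk.trans h1)
    rw [codeSize_nat]
    simp only [T, Polynomial.eval_add, Polynomial.eval_mul, Polynomial.eval_C, Polynomial.eval_one]
    omega
  have h5 := key _ le_rfl
  have h6 := codeSize_list_le (l := ((List.range l'.length).map (b * Q ^ ·)).reverse)
    (by simpa using h1) (c := T.eval (codeSize a) + 1) fun x hx => by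
      simp only [List.mem_reverse, List.mem_map, List.mem_range] at hx
      obtain ⟨k, hk, rfl⟩ := hx
      exact key k hk.le
  rw [foldl_geomList]
  refine (codeSize_pair _ _).trans_le ?_
  simp only [Polynomial.eval_add, Polynomial.eval_mul, Polynomial.eval_one]
  omega

end PolyTime

/-! ### The steps of the reduction -/

/-- One round of the computation of paths. The list `pts` holds, for every vertex, a path from that
vertex to the root, or the empty list if none has been found yet. -/
def stepPaths (M : List (List (ℕ × ℕ))) (pts : List (List ℕ)) : List (List ℕ) :=
  (List.range M.length).map fun v => if pts.getD v [] = [] then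
    ((List.range M.length).map fun u => if 0 < (matEntry M u v).2 ∧ ¬ pts.getD u [] = [] then
      [v :: pts.getD u []] else []).flatten.headD [] else pts.getD v []

/-- The paths without edges: only the one of the root `r`. -/
def initPaths (M : List (List (ℕ × ℕ))) (r : ℕ) : List (List ℕ) :=
  (List.range M.length).map fun v => if v = r then [r] else []

/-- Paths from all vertices to the root. The number of rounds is the number of vertices, which exceeds
the number of edges of every path. -/
def rootPaths (M : List (List (ℕ × ℕ))) (r : ℕ) : List (List ℕ) :=
  M.foldl (fun pts _ => stepPaths M pts) (initPaths M r)

/-- Distances of all vertices from the root. -/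
def rootDists (M : List (List (ℕ × ℕ))) (r : ℕ) : List (ℕ × ℕ) :=
  (rootPaths M r).map fun p => walkFrac M p

/-- The demands of the vertices whose distance from the root is at least `a` and less than `Q * a`;
the other demands are replaced by zero. -/
def maskDemands (ds : List (ℕ × ℕ)) (dem : List ℕ) (Q : ℕ) (a : ℕ × ℕ) : List ℕ :=
  (List.range dem.length).map fun v =>
    if a.1 * (ds.getD v (0, 0)).2 ≤ (ds.getD v (0, 0)).1 * a.2 ∧
      (ds.getD v (0, 0)).1 * a.2 < Q * a.1 * (ds.getD v (0, 0)).2 then dem.getD v 0 else 0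

/-- The number of tours that serve a demand `d` at a vertex at distance zero: a single one if the
demand must not be split, and otherwise `d` tours with load one, which respect every capacity. -/
def tourMult (ver : Version) (d : ℕ) : ℕ :=
  match ver with
  | .unsplittable => 1
  | _ => d

/-- The load of each of the tours that serve a demand `d` at a vertex at distance zero. -/
def tourLoad (ver : Version) (d : ℕ) : ℕ :=
  match ver with
  | .unsplittable => d
  | _ => 1

/-- Tours that serve the demands at distance zero, each of them at one vertex only. -/
def zeroTours (ver : Version) (pts : List (List ℕ)) (ds : List (ℕ × ℕ)) (dem : List ℕ) :
    List (ℕ × List ℕ × List ℕ) :=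
  ((List.range dem.length).map fun v => if (ds.getD v (0, 0)).1 = 0 then
    [(tourMult ver (dem.getD v 0), (pts.getD v []).reverse ++ (pts.getD v []).tail,
      (List.range dem.length).map fun u => if u = v then tourLoad ver (dem.getD v 0) else 0)]
    else []).flatten

/-- The cost of a list of tours with multiplicities. -/
def planFrac (M : List (List (ℕ × ℕ))) (S : List (ℕ × List ℕ × List ℕ)) : ℕ × ℕ :=
  fracSum (S.map fun e => (e.1 * (walkFrac M e.2.1).1, (walkFrac M e.2.1).2))

theorem length_stepPaths (M : List (List (ℕ × ℕ))) (pts : List (List ℕ)) :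
    (stepPaths M pts).length = M.length := by simp [stepPaths]

theorem List.mem_or_eq_of_getD {α : Type} {l : List α} {i : ℕ} {d : α} :
    l.getD i d ∈ l ∨ l.getD i d = d := by
  rw [List.getD]
  cases h : l[i]? with
  | none => right; rfl
  | some a => left; exact List.mem_of_getElem? h

/-- After `k` rounds, all paths have at most `k + 1` vertices. -/
theorem mem_foldl_stepPaths (M : List (List (ℕ × ℕ))) (r : ℕ) (l : List (List (ℕ × ℕ))) :
    (l.foldl (fun pts _ => stepPaths M pts) (initPaths M r)).length = M.length ∧
    ∀ p ∈ l.foldl (fun pts _ => stepPaths M pts) (initPaths M r),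
      p.length ≤ l.length + 1 ∧ ∀ v ∈ p, v < M.length := by
  induction l using List.reverseRecOn with
  | nil =>
    refine ⟨by simp [initPaths], fun p hp => ?_⟩
    simp only [List.foldl_nil, initPaths, List.mem_map, List.mem_range] at hp
    obtain ⟨v, hv, rfl⟩ := hp
    split_ifs with h
    · subst h; simpa using hv
    · simp
  | append_singleton l x ih =>
    rw [List.foldl_append, List.foldl_cons, List.foldl_nil]
    generalize l.foldl (fun pts _ => stepPaths M pts) (initPaths M r) = pts at ih
    refine ⟨length_stepPaths _ _, fun p hp => ?_⟩
    have hget : ∀ u, (pts.getD u []).length ≤ l.length + 1 ∧ ∀ v ∈ pts.getD u [], v < M.length := by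
      intro u
      rcases List.mem_or_eq_of_getD (l := pts) (i := u) (d := []) with h | h
      · exact ih.2 _ h
      · rw [h]; simp
    simp only [stepPaths, List.mem_map, List.mem_range] at hp
    obtain ⟨v, hv, rfl⟩ := hp
    rw [List.length_append, List.length_singleton]
    split_ifs with h
    · generalize hL : (((List.range M.length).map fun u =>
        if 0 < (matEntry M u v).2 ∧ ¬ pts.getD u [] = [] then
          [v :: pts.getD u []] else []).flatten) = L
      cases L with
      | nil => simp
      | cons p L =>
        have : p ∈ p :: L := by simp
        rw [← hL] at this
        simp only [List.mem_flatten, List.mem_map, List.mem_range] at this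
        obtain ⟨_, ⟨u, hu, rfl⟩, hp⟩ := this
        split_ifs at hp
        · obtain rfl : p = _ := by simpa using hp
          have h1 := hget u
          refine ⟨by simpa using h1.1, fun w hw => ?_⟩
          rcases List.mem_cons.1 hw with rfl | hw
          · exact hv
          · exact h1.2 w hw
        · simp at hp
    · exact ⟨(hget v).1.trans (by omega), (hget v).2⟩

namespace PolyTime

variable {α β : Type} [ValCode α] [ValCode β]

@[fun_prop]
theorem stepPaths {M : α → List (List (ℕ × ℕ))} {pts : α → List (List ℕ)} (hM : PolyTime M)
    (hp : PolyTime pts) : PolyTime fun a => stepPaths (M a) (pts a) := by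
  refine map (ite (by fun_prop) (headD [] rfl (flatten (map ?_ (by fun_prop)))) (by fun_prop))
    (by fun_prop)
  fun_prop

@[fun_prop]
theorem initPaths {M : α → List (List (ℕ × ℕ))} {r : α → ℕ} (hM : PolyTime M)
    (hr : PolyTime r) : PolyTime fun a => initPaths (M a) (r a) :=
  map (by fun_prop) (by fun_prop)

@[fun_prop]
theorem rootPaths {M : α → List (List (ℕ × ℕ))} {r : α → ℕ} (hM : PolyTime M)
    (hr : PolyTime r) : PolyTime fun a => rootPaths (M a) (r a) := by
  obtain ⟨L, hL⟩ := hM.size_le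
  refine foldl (by fun_prop) (by fun_prop) hM (L * ((L + 1) * (L + 1 + 1) + 1 + 1) + 1)
    fun a l h => ?_
  obtain ⟨h1, h2⟩ := mem_foldl_stepPaths (M a) (r a) l
  have h3 := (length_le_codeSize _).trans (hL a)
  simp only [Polynomial.eval_add, Polynomial.eval_mul, Polynomial.eval_one]
  refine codeSize_list_le (h1.trans_le h3) fun p hp => codeSize_list_le ?_ fun v hv => ?_
  · have := (h2 p hp).1
    have := h.length_le
    omega
  · have := (h2 p hp).2 v hv
    have := Nat.size_le_self v
    rw [codeSize_nat]
    omega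

@[fun_prop]
theorem rootDists {M : α → List (List (ℕ × ℕ))} {r : α → ℕ} (hM : PolyTime M)
    (hr : PolyTime r) : PolyTime fun a => rootDists (M a) (r a) :=
  map (by fun_prop) (by fun_prop)

@[fun_prop]
theorem maskDemands {ds : α → List (ℕ × ℕ)} {dem : α → List ℕ} (Q : ℕ) {c : α → ℕ × ℕ}
    (hds : PolyTime ds) (hdem : PolyTime dem) (hc : PolyTime c) :
    PolyTime fun a => maskDemands (ds a) (dem a) Q (c a) :=
  map (by fun_prop) (by fun_prop)

@[fun_prop]
theorem tourMult (ver : Version) {d : α → ℕ} (hd : PolyTime d) :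
    PolyTime fun a => tourMult ver (d a) := by
  cases ver <;> unfold _root_.tourMult <;> fun_prop

@[fun_prop]
theorem tourLoad (ver : Version) {d : α → ℕ} (hd : PolyTime d) :
    PolyTime fun a => tourLoad ver (d a) := by
  cases ver <;> unfold _root_.tourLoad <;> fun_prop

@[fun_prop]
theorem zeroTours (ver : Version) {pts : α → List (List ℕ)} {ds : α → List (ℕ × ℕ)}
    {dem : α → List ℕ} (hp : PolyTime pts) (hds : PolyTime ds) (hdem : PolyTime dem) :
    PolyTime fun a => zeroTours ver (pts a) (ds a) (dem a) := by
  refine flatten (map (ite (by fun_prop) (cons (prodMk (by fun_prop) (prodMk (by fun_prop)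
    (map ?_ (by fun_prop)))) (by fun_prop)) (by fun_prop)) (by fun_prop))
  fun_prop

@[fun_prop]
theorem planFrac {M : α → List (List (ℕ × ℕ))} {S : α → List (ℕ × List ℕ × List ℕ)}
    (hM : PolyTime M) (hS : PolyTime S) : PolyTime fun a => planFrac (M a) (S a) :=
  fracSum (map (by fun_prop) (by fun_prop))

end PolyTime

/-! ### Paths to the root -/

namespace DepotTree

open SimpleGraph

variable (T : DepotTree)

/-- The path from the root to `v`. -/
noncomputable def rootPath (v : Fin T.n) : T.graph.Walk T.root v :=
  (T.isTree.existsUnique_path T.root v).choose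

/-- The parent of `v`; the root counts as its own parent. -/
noncomputable def parent (v : Fin T.n) : Fin T.n := (T.rootPath v).penultimate

/-- The ancestors of `v`, including `v` itself. -/
noncomputable def anc (v : Fin T.n) : Finset (Fin T.n) := (T.rootPath v).support.toFinset

theorem isPath_rootPath (v : Fin T.n) : (T.rootPath v).IsPath :=
  (T.isTree.existsUnique_path T.root v).choose_spec.1

variable {T}

theorem eq_rootPath {v : Fin T.n} {p : T.graph.Walk T.root v} (hp : p.IsPath) :
    p = T.rootPath v :=
  (T.isTree.existsUnique_path T.root v).choose_spec.2 p hp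

theorem dist_eq (v : Fin T.n) : T.dist v = T.walkWeight (T.rootPath v) := rfl

theorem walkWeight_append {u v w : Fin T.n} (p : T.graph.Walk u v) (q : T.graph.Walk v w) :
    T.walkWeight (p.append q) = T.walkWeight p + T.walkWeight q := by
  simp [walkWeight]

theorem walkWeight_reverse {u v : Fin T.n} (p : T.graph.Walk u v) :
    T.walkWeight p.reverse = T.walkWeight p := by
  simp [walkWeight, List.sum_reverse]

theorem walkWeight_concat {u v w : Fin T.n} (p : T.graph.Walk u v) (h : T.graph.Adj v w) :
    T.walkWeight (p.concat h) = T.walkWeight p + T.weight s(v, w) := by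
  simp [walkWeight, Walk.edges_concat]

theorem rootPath_root : T.rootPath T.root = .nil := (eq_rootPath Walk.IsPath.nil).symm

theorem dist_root : T.dist T.root = 0 := by
  rw [dist_eq, rootPath_root]; simp [walkWeight]

theorem takeUntil_rootPath {u v : Fin T.n} (h : u ∈ (T.rootPath v).support) :
    (T.rootPath v).takeUntil u h = T.rootPath u :=
  eq_rootPath ((T.isPath_rootPath v).takeUntil h)

theorem rootPath_concat {u v : Fin T.n} (h : T.graph.Adj u v)
    (hv : v ∉ (T.rootPath u).support) : T.rootPath v = (T.rootPath u).concat h :=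
  (eq_rootPath ((T.isPath_rootPath u).concat hv h)).symm

/-- Along an edge, one of the two paths to the root extends the other. -/
theorem rootPath_adj {u v : Fin T.n} (h : T.graph.Adj u v) :
    T.rootPath v = (T.rootPath u).concat h ∨ T.rootPath u = (T.rootPath v).concat h.symm := by
  by_cases hv : v ∈ (T.rootPath u).support
  · right
    refine rootPath_concat h.symm ?_
    rw [← takeUntil_rootPath hv]
    exact Walk.endpoint_notMem_support_takeUntil (T.isPath_rootPath u) hv h.ne
  · exact .inl (rootPath_concat h hv)

theorem parent_root : T.parent T.root = T.root := by
  rw [parent, rootPath_root, Walk.penultimate_nil]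

theorem parent_adj {v : Fin T.n} (hv : v ≠ T.root) : T.graph.Adj (T.parent v) v :=
  Walk.adj_penultimate (Walk.not_nil_of_ne hv.symm)

theorem rootPath_eq_concat {v : Fin T.n} (hv : v ≠ T.root) :
    T.rootPath v = (T.rootPath (T.parent v)).concat (parent_adj hv) := by
  have : (T.rootPath v).dropLast = T.rootPath (T.parent v) :=
    eq_rootPath (T.isPath_rootPath v).dropLast
  rw [← this]
  exact (Walk.concat_dropLast _).symm

theorem dist_eq_parent {v : Fin T.n} (hv : v ≠ T.root) :
    T.dist v = T.dist (T.parent v) + T.weight s(T.parent v, v) := by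
  rw [dist_eq, rootPath_eq_concat hv, walkWeight_concat, dist_eq]

theorem dist_parent_le (v : Fin T.n) : T.dist (T.parent v) ≤ T.dist v := by
  by_cases hv : v = T.root
  · rw [hv, parent_root]
  · rw [dist_eq_parent hv]; exact le_self_add

theorem length_rootPath {v : Fin T.n} (hv : v ≠ T.root) :
    (T.rootPath v).length = (T.rootPath (T.parent v)).length + 1 := by
  conv_lhs => rw [rootPath_eq_concat hv]
  rw [Walk.length_concat]

theorem parent_induction {motive : Fin T.n → Prop} (root : motive T.root)
    (step : ∀ v, v ≠ T.root → motive (T.parent v) → motive v) (v : Fin T.n) : motive v := by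
  induction h : (T.rootPath v).length using Nat.strong_induction_on generalizing v with
  | _ k ih =>
    by_cases hv : v = T.root
    · rwa [hv]
    · exact step v hv (ih _ (by rw [← h, length_rootPath hv]; omega) _ rfl)

theorem mem_anc {u v : Fin T.n} : u ∈ T.anc v ↔ u ∈ (T.rootPath v).support := by simp [anc]

theorem mem_anc_self (v : Fin T.n) : v ∈ T.anc v := mem_anc.2 (Walk.end_mem_support _)

theorem anc_root : T.anc T.root = {T.root} := by ext; simp [mem_anc, rootPath_root]

theorem anc_eq_insert {v : Fin T.n} (hv : v ≠ T.root) :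
    T.anc v = insert v (T.anc (T.parent v)) := by
  ext u
  rw [mem_anc, rootPath_eq_concat hv, Walk.support_concat]
  simp [mem_anc, or_comm]

theorem notMem_anc_parent {v : Fin T.n} (hv : v ≠ T.root) : v ∉ T.anc (T.parent v) := by
  have := T.isPath_rootPath v
  rw [rootPath_eq_concat hv, Walk.concat_isPath_iff] at this
  rw [mem_anc]; exact this.2

theorem anc_subset {u v : Fin T.n} (h : u ∈ T.anc v) : T.anc u ⊆ T.anc v := by
  intro w hw
  rw [mem_anc] at *
  rw [← takeUntil_rootPath h] at hw
  exact Walk.support_takeUntil_subset_support _ h hw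

theorem dist_le_of_mem_anc {u v : Fin T.n} (h : u ∈ T.anc v) : T.dist u ≤ T.dist v := by
  rw [mem_anc] at h
  rw [dist_eq v, ← Walk.take_spec _ h, walkWeight_append, takeUntil_rootPath h, dist_eq]
  exact le_self_add

theorem sum_anc (g : Fin T.n → ℝ) (x : Fin T.n) :
    ∑ v ∈ T.anc x, (g v - g (T.parent v)) = g x - g T.root := by
  induction x using parent_induction with
  | root => simp [anc_root, parent_root]
  | step v hv ih =>
    rw [anc_eq_insert hv, Finset.sum_insert (notMem_anc_parent hv), ih]; ring

/-! ### Subtrees that contain the root -/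

/-- The smallest subtree that contains the root and all vertices of `X`. -/
noncomputable def hull (X : Finset (Fin T.n)) : Finset (Fin T.n) := insert T.root (X.biUnion T.anc)

theorem mem_hull {X : Finset (Fin T.n)} {v : Fin T.n} :
    v ∈ hull X ↔ v = T.root ∨ ∃ x ∈ X, v ∈ T.anc x := by simp [hull]

theorem hull_empty : hull (∅ : Finset (Fin T.n)) = {T.root} := rfl

theorem hull_insert (x : Fin T.n) (X : Finset (Fin T.n)) : hull (insert x X) = hull X ∪ T.anc x := by
  ext v; simp only [mem_hull, Finset.mem_union, Finset.exists_mem_insert, or_assoc, or_comm (a := v ∈ T.anc x)]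

theorem hull_mono {X Y : Finset (Fin T.n)} (h : X ⊆ Y) : hull X ⊆ hull Y := by
  intro v; simp only [mem_hull]
  rintro (h' | ⟨x, hx, h'⟩)
  exacts [.inl h', .inr ⟨x, h hx, h'⟩]

theorem anc_subset_hull {X : Finset (Fin T.n)} {v : Fin T.n} (h : v ∈ hull X) :
    T.anc v ⊆ hull X := by
  rcases mem_hull.1 h with rfl | ⟨x, hx, h'⟩
  · rw [anc_root]; simpa using h
  · exact fun w hw => mem_hull.2 (.inr ⟨x, hx, anc_subset h' hw⟩)

/-- The path from the root to `x` leaves a subtree at some vertex `y` of that subtree. -/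
theorem exists_branch (X : Finset (Fin T.n)) (x : Fin T.n) :
    ∃ y ∈ hull X, y ∈ T.anc x ∧ hull X ∩ T.anc x = T.anc y := by
  induction x using parent_induction with
  | root =>
    have : T.root ∈ hull X := mem_hull.2 (.inl rfl)
    exact ⟨_, this, mem_anc_self _, Finset.inter_eq_right.2 (anc_subset_hull this)⟩
  | step v hv ih =>
    by_cases h : v ∈ hull X
    · exact ⟨_, h, mem_anc_self _, Finset.inter_eq_right.2 (anc_subset_hull h)⟩
    · obtain ⟨y, hy, hy', hy''⟩ := ih
      refine ⟨y, hy, by rw [anc_eq_insert hv]; exact Finset.mem_insert_of_mem hy', ?_⟩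
      rw [anc_eq_insert hv, Finset.inter_insert_of_notMem h, hy'']

/-- When `x` is added, the subtree grows by the path from the branching vertex `y` to `x`, over which
the differences telescope. -/
theorem sum_hull_insert (g : Fin T.n → ℝ) {X : Finset (Fin T.n)} {x y : Fin T.n}
    (h : hull X ∩ T.anc x = T.anc y) :
    ∑ v ∈ hull (insert x X), (g v - g (T.parent v)) =
      ∑ v ∈ hull X, (g v - g (T.parent v)) + (g x - g y) := by
  have := Finset.sum_union_inter (s₁ := hull X) (s₂ := T.anc x) (f := fun v => g v - g (T.parent v))
  rw [h, sum_anc, sum_anc] at this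
  rw [hull_insert]; linarith

/-- The weight of the part of the subtree spanned by `X` that is at distance at most `y` from the
root. -/
noncomputable def lowWeight (X : Finset (Fin T.n)) (y : ℝ) : ℝ :=
  ∑ v ∈ hull X, (min (T.dist v : ℝ) y - min (T.dist (T.parent v) : ℝ) y)

/-- The weight of the subtree spanned by `X`. -/
noncomputable def hullWeight (X : Finset (Fin T.n)) : ℝ :=
  ∑ v ∈ hull X, ((T.dist v : ℝ) - T.dist (T.parent v))

/-- If all vertices of `X` are at distance at least `a`, then the number of edges of the subtree at
distance `y` is nondecreasing for `y ≤ a`, so its mean over `[0, b]` is at most the mean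
over `[0, a]`. -/
theorem mul_lowWeight_le {X : Finset (Fin T.n)} {a b : ℝ} (hb : 0 ≤ b) (hab : b ≤ a)
    (hX : ∀ x ∈ X, a ≤ (T.dist x : ℝ)) : a * lowWeight X b ≤ b * lowWeight X a := by
  induction X using Finset.induction_on with
  | empty => simp [lowWeight, hull_empty, parent_root]
  | insert x X _ ih =>
    obtain ⟨y, -, -, hy⟩ := exists_branch X x
    have h1 := ih fun x hx => hX x (Finset.mem_insert_of_mem hx)
    have h2 := hX x (Finset.mem_insert_self _ _)
    have h3 : (0 : ℝ) ≤ T.dist y := by positivity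
    rw [lowWeight, sum_hull_insert (fun v => min (T.dist v : ℝ) b) hy, lowWeight,
      sum_hull_insert (fun v => min (T.dist v : ℝ) a) hy, min_eq_right h2, min_eq_right (hab.trans h2)]
    -- the new path contributes the positive part of `t - dist y` below `t`, a convex function of `t`
    have h4 : a * (b - min (T.dist y : ℝ) b) ≤ b * (a - min (T.dist y : ℝ) a) := by
      rcases le_total b (T.dist y) with h | h
      · rw [min_eq_right h, sub_self, mul_zero]
        exact mul_nonneg hb (sub_nonneg.2 (min_le_right _ _))
      · rw [min_eq_left h, min_eq_left (h.trans hab)]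
        nlinarith
    unfold lowWeight at h1
    linarith

/-- The part of a single edge between the distances `a` and `b` has nonnegative weight. -/
theorem lowWeight_sub_nonneg (v : Fin T.n) {a b : ℝ} (hab : a ≤ b) :
    0 ≤ (min (T.dist v : ℝ) b - min (T.dist (T.parent v) : ℝ) b) -
      (min (T.dist v : ℝ) a - min (T.dist (T.parent v) : ℝ) a) := by
  have h : (T.dist (T.parent v) : ℝ) ≤ T.dist v := by exact_mod_cast dist_parent_le v
  rcases le_total (T.dist v : ℝ) a with h1 | h1 <;> rcases le_total (T.dist v : ℝ) b with h2 | h2 <;>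
  rcases le_total (T.dist (T.parent v) : ℝ) a with h3 | h3 <;>
  rcases le_total (T.dist (T.parent v) : ℝ) b with h4 | h4 <;>
  simp only [min_eq_left, min_eq_right, h1, h2, h3, h4] <;> linarith

theorem lowWeight_sub_le {X Y : Finset (Fin T.n)} (h : X ⊆ Y) {a b : ℝ} (hab : a ≤ b) :
    lowWeight X b - lowWeight X a ≤ lowWeight Y b - lowWeight Y a := by
  simp only [lowWeight, ← Finset.sum_sub_distrib]
  exact Finset.sum_le_sum_of_subset_of_nonneg (hull_mono h) fun v _ _ => lowWeight_sub_nonneg v hab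

theorem lowWeight_nonneg (X : Finset (Fin T.n)) (a : ℝ) : 0 ≤ lowWeight X a := by
  refine Finset.sum_nonneg fun v _ => sub_nonneg.2 (min_le_min_right _ ?_)
  exact_mod_cast dist_parent_le v

theorem lowWeight_le_hullWeight (X : Finset (Fin T.n)) (a : ℝ) : lowWeight X a ≤ hullWeight X := by
  refine Finset.sum_le_sum fun v _ => ?_
  have h : (T.dist (T.parent v) : ℝ) ≤ T.dist v := by exact_mod_cast dist_parent_le v
  rcases le_total (T.dist v : ℝ) a with h1 | h1 <;>
  rcases le_total (T.dist (T.parent v) : ℝ) a with h3 | h3 <;>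
  simp only [min_eq_left, min_eq_right, h1, h3] <;> linarith

theorem hullWeight_eq_lowWeight {X : Finset (Fin T.n)} {a : ℝ} (h0 : 0 ≤ a)
    (h : ∀ x ∈ X, (T.dist x : ℝ) ≤ a) : hullWeight X = lowWeight X a := by
  refine Finset.sum_congr rfl fun v hv => ?_
  have h1 : (T.dist v : ℝ) ≤ a := by
    rcases mem_hull.1 hv with rfl | ⟨x, hx, hv⟩
    · simpa [dist_root] using h0
    · exact le_trans (by exact_mod_cast dist_le_of_mem_anc hv) (h x hx)
  have h2 : (T.dist (T.parent v) : ℝ) ≤ T.dist v := by exact_mod_cast dist_parent_le v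
  rw [min_eq_left h1, min_eq_left (h2.trans h1)]

/-- A depth-first traversal: the subtree spanned by `X` can be visited by a closed walk that uses each
of its edges twice. -/
theorem exists_closedWalk (X : Finset (Fin T.n)) : ∃ p : T.graph.Walk T.root T.root,
    hull X ⊆ p.support.toFinset ∧ (T.walkWeight p : ℝ) = 2 * hullWeight X := by
  induction X using Finset.induction_on with
  | empty => exact ⟨.nil, by simp [hull_empty], by simp [walkWeight, hullWeight, hull_empty, parent_root]⟩
  | insert x X _ ih =>
    obtain ⟨p, hp, hw⟩ := ih
    obtain ⟨y, hy, hyx, hxy⟩ := exists_branch X x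
    have hyp : y ∈ p.support := by simpa using hp hy
    have hyx := mem_anc.1 hyx
    have hspec := Walk.take_spec _ hyx
    have hdist : T.dist x = T.dist y + T.walkWeight ((T.rootPath x).dropUntil y hyx) := by
      rw [dist_eq x, dist_eq y, ← takeUntil_rootPath hyx, ← walkWeight_append, hspec]
    generalize (T.rootPath x).dropUntil y hyx = q at *
    -- the detour `q` from `y` to `x` and back is inserted at a visit of `y`
    refine ⟨(p.takeUntil y hyp).append ((q.append q.reverse).append (p.dropUntil y hyp)), ?_, ?_⟩
    · rw [hull_insert]
      refine Finset.union_subset (fun v hv => ?_) fun v hv => ?_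
      · have := hp hv
        rw [List.mem_toFinset, ← Walk.take_spec p hyp, Walk.mem_support_append_iff] at this
        rw [List.mem_toFinset, Walk.mem_support_append_iff, Walk.mem_support_append_iff]
        tauto
      · have h1 := mem_anc.1 hv
        rw [← hspec, Walk.mem_support_append_iff] at h1
        rw [List.mem_toFinset, Walk.mem_support_append_iff, Walk.mem_support_append_iff,
          Walk.mem_support_append_iff]
        rcases h1 with h1 | h1
        · rw [takeUntil_rootPath hyx, ← mem_anc] at h1
          have := hp (anc_subset_hull hy h1)
          rw [List.mem_toFinset, ← Walk.take_spec p hyp, Walk.mem_support_append_iff] at this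
          tauto
        · tauto
    · have h1 : T.walkWeight p = T.walkWeight (p.takeUntil y hyp) + T.walkWeight (p.dropUntil y hyp) := by
        rw [← walkWeight_append, Walk.take_spec]
      rw [hullWeight, sum_hull_insert (fun v => (T.dist v : ℝ)) hxy]
      rw [hullWeight, h1] at hw
      simp only [walkWeight_append, walkWeight_reverse]
      push_cast at hw ⊢
      rw [hdist]; push_cast
      linarith

/-- Every walk from the root to `x` uses all edges of the path to `x`. -/
theorem mem_edges_of_mem_anc {v x : Fin T.n} (hv : v ≠ T.root) (h : v ∈ T.anc x)
    (p : T.graph.Walk T.root x) : s(T.parent v, v) ∈ p.edges := by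
  apply p.edges_bypass_subset_edges
  rw [eq_rootPath p.bypass_isPath]
  rw [mem_anc] at h
  rw [← Walk.take_spec _ h, Walk.edges_append, takeUntil_rootPath h, rootPath_eq_concat hv,
    Walk.edges_concat]
  simp

/-- A closed walk from the root traverses every edge of the subtree spanned by the vertices that it
visits at least twice, on the way there and on the way back. -/
theorem two_mul_hullWeight_le {X : Finset (Fin T.n)} (p : T.graph.Walk T.root T.root)
    (hX : ∀ x ∈ X, x ∈ p.support) : 2 * hullWeight X ≤ T.walkWeight p := by
  set U := (hull X).erase T.root with hU
  have hUr : ∀ v ∈ U, v ≠ T.root := fun v hv => Finset.ne_of_mem_erase hv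
  have hinj : Set.InjOn (fun v => s(T.parent v, v)) U := by
    intro u hu v hv h
    rcases Sym2.eq_iff.1 h with h | h
    · exact h.2
    · exfalso
      have h1 := length_rootPath (hUr u hu)
      have h2 := length_rootPath (hUr v hv)
      rw [h.1] at h1
      rw [← h.2] at h2
      omega
  -- a visit of `x` below `v` cuts the walk into two parts, and both use the edge above `v`
  have hcount : ∀ v ∈ U, 2 ≤ p.edges.count s(T.parent v, v) := by
    intro v hv
    have hvr := hUr v hv
    obtain ⟨x, hx, hvx⟩ := (mem_hull.1 (Finset.mem_of_mem_erase hv)).resolve_left hvr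
    have hxp := hX x hx
    rw [← Walk.take_spec p hxp, Walk.edges_append, List.count_append]
    have h1 := List.one_le_count_iff.2 (mem_edges_of_mem_anc hvr hvx (p.takeUntil x hxp))
    have h2 := mem_edges_of_mem_anc hvr hvx (p.dropUntil x hxp).reverse
    rw [Walk.edges_reverse, List.mem_reverse] at h2
    have h2 := List.one_le_count_iff.2 h2
    omega
  have h1 : hullWeight X = ∑ v ∈ U, (T.weight s(T.parent v, v) : ℝ) := by
    rw [hullWeight, ← Finset.add_sum_erase _ _ (mem_hull.2 (.inl rfl) : T.root ∈ hull X),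
      parent_root, sub_self, zero_add]
    refine Finset.sum_congr rfl fun v hv => ?_
    rw [dist_eq_parent (hUr v hv)]; push_cast; ring
  have h2 : T.walkWeight p = ∑ e ∈ p.edges.toFinset, p.edges.count e • T.weight e :=
    Finset.sum_list_map_count _ _
  have h3 : ∑ v ∈ U, 2 * T.weight s(T.parent v, v) ≤ T.walkWeight p := by
    rw [h2, ← Finset.sum_image (f := fun e => 2 * T.weight e) hinj]
    calc _ ≤ ∑ e ∈ U.image fun v => s(T.parent v, v), p.edges.count e • T.weight e := by
          refine Finset.sum_le_sum fun e he => ?_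
          obtain ⟨v, hv, rfl⟩ := Finset.mem_image.1 he
          rw [nsmul_eq_mul]
          gcongr
          exact_mod_cast hcount v hv
      _ ≤ _ := by
          refine Finset.sum_le_sum_of_subset fun e he => ?_
          obtain ⟨v, hv, rfl⟩ := Finset.mem_image.1 he
          rw [List.mem_toFinset]
          exact List.count_pos_iff.1 (by have := hcount v hv; omega)
  rw [h1, Finset.mul_sum]
  exact_mod_cast h3

end DepotTree

/-! ### Splitting a tour into groups of similar distances -/

namespace DepotTree

variable {T : DepotTree}

/-- The part of a tour that serves the vertices with the property `G`, on a shortest walk. -/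
theorem exists_restrict_tour (t : T.Tour) (G : Fin T.n → Prop) [DecidablePred G] :
    ∃ t' : T.Tour, (∀ v, t'.load v = if G v then t.load v else 0) ∧
      (T.walkWeight t'.walk : ℝ) =
        2 * hullWeight (Finset.univ.filter fun v => t.load v ≠ 0 ∧ G v) := by
  obtain ⟨p, hp, hw⟩ := exists_closedWalk (Finset.univ.filter fun v => t.load v ≠ 0 ∧ G v)
  refine ⟨⟨p, fun v => if G v then t.load v else 0, fun v hv => ?_⟩, fun v => rfl, hw⟩
  rw [← List.mem_toFinset]
  refine hp (mem_hull.2 (.inr ⟨v, ?_, mem_anc_self v⟩))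
  by_cases h : G v
  · simpa [h] using hv
  · simp [h] at hv

/-- The cost of the part of a subtree that is spanned by vertices at distance between `a` and
`Q * a`: apart from the edges in that range, it is charged to the edges at distance
between `a / q` and `a`. -/
theorem hullWeight_group_le {X Y : Finset (Fin T.n)} (h : X ⊆ Y) {a q Q : ℝ} (ha : 0 < a)
    (hq : 1 < q) (hQ : 1 ≤ Q) (hX : ∀ x ∈ X, a ≤ (T.dist x : ℝ) ∧ (T.dist x : ℝ) < Q * a) :
    hullWeight X ≤ (lowWeight Y (Q * a) - lowWeight Y a) +
      q / (q - 1) * (lowWeight Y a - lowWeight Y (a / q)) := by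
  have hq0 : 0 < q := by linarith
  have hq1 : 0 < q - 1 := by linarith
  have haq : a / q ≤ a := div_le_self ha.le hq.le
  have h1 := mul_lowWeight_le (X := X) (a := a) (b := a / q) (by positivity) haq
    fun x hx => (hX x hx).1
  have h2 : q * lowWeight X (a / q) ≤ lowWeight X a := by
    rw [div_mul_eq_mul_div, le_div_iff₀ hq0] at h1
    exact le_of_mul_le_mul_left (by linarith) ha
  have h3 : lowWeight X a ≤ q / (q - 1) * (lowWeight X a - lowWeight X (a / q)) := by
    rw [div_mul_eq_mul_div, le_div_iff₀ hq1]; linarith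
  have h4 := mul_le_mul_of_nonneg_left (lowWeight_sub_le h haq) (div_pos hq0 hq1).le
  have h5 := lowWeight_sub_le h (le_mul_of_one_le_left ha.le hQ)
  rw [hullWeight_eq_lowWeight (by positivity) fun x hx => (hX x hx).2.le]
  linarith

/-- The tours into which `t` is split, for all shifts `s` and all groups `j` of distances between
`a * q ^ s * Q ^ j` and `a * q ^ s * Q ^ (j + 1)`, where `Q = q ^ P`. -/
theorem exists_split_tours (t : T.Tour) {a : ℝ} (ha : 0 < a) {q : ℕ} (hq : 2 ≤ q) (P J : ℕ) :
    ∃ t' : ℕ → ℕ → T.Tour,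
      (∀ s j v, (t' s j).load v = open Classical in
        if a * q ^ s * (q ^ P : ℝ) ^ j ≤ T.dist v ∧
          (T.dist v : ℝ) < q ^ P * (a * q ^ s * (q ^ P : ℝ) ^ j) then t.load v else 0) ∧
      ∑ s ∈ Finset.range P, ∑ j ∈ Finset.range J, (T.walkWeight (t' s j).walk : ℝ) ≤
        (P + q / (q - 1)) * T.walkWeight t.walk := by
  classical
  choose t' hload hw using fun s j : ℕ => exists_restrict_tour t fun v =>
    a * q ^ s * (q ^ P : ℝ) ^ j ≤ T.dist v ∧
      (T.dist v : ℝ) < q ^ P * (a * q ^ s * (q ^ P : ℝ) ^ j)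
  refine ⟨t', fun s j v => by rw [hload], ?_⟩
  have hq1 : (1 : ℝ) < q := by exact_mod_cast hq
  have hq0 : (0 : ℝ) < q := by linarith
  set r : ℝ := q / (q - 1)
  have hr : 0 ≤ r := div_nonneg hq0.le (by linarith)
  set Y : Finset (Fin T.n) := Finset.univ.filter fun v => t.load v ≠ 0
  have hY : 2 * hullWeight Y ≤ T.walkWeight t.walk :=
    two_mul_hullWeight_le _ fun x hx => t.load_support x (by simpa [Y] using hx)
  have h1 : ∀ s j : ℕ, (T.walkWeight (t' s j).walk : ℝ) ≤
      2 * ((lowWeight Y (a * q ^ s * (q ^ P : ℝ) ^ (j + 1)) -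
        lowWeight Y (a * q ^ s * (q ^ P : ℝ) ^ j)) +
      r * (lowWeight Y (a * q ^ (s + 1) * (q ^ P : ℝ) ^ j / q) -
        lowWeight Y (a * q ^ s * (q ^ P : ℝ) ^ j / q))) := by
    intro s j
    rw [hw]
    have := hullWeight_group_le (X := Finset.univ.filter fun v => t.load v ≠ 0 ∧
      (a * q ^ s * (q ^ P : ℝ) ^ j ≤ T.dist v ∧
      (T.dist v : ℝ) < q ^ P * (a * q ^ s * (q ^ P : ℝ) ^ j))) (Y := Y)
      (fun v => by simp only [Y, Finset.mem_filter]; tauto) (a := a * q ^ s * (q ^ P : ℝ) ^ j)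
      (q := q) (Q := q ^ P) (by positivity) hq1 (one_le_pow₀ hq1.le)
      fun x hx => (Finset.mem_filter.1 hx).2.2
    have e1 : (q : ℝ) ^ P * (a * q ^ s * (q ^ P) ^ j) = a * q ^ s * (q ^ P : ℝ) ^ (j + 1) := by ring
    have e2 : a * q ^ (s + 1) * (q ^ P : ℝ) ^ j / q = a * q ^ s * (q ^ P : ℝ) ^ j := by
      rw [pow_succ]; field_simp
    rw [e1] at this
    rw [e2]
    simp only [e1] at *
    linarith
  -- both differences telescope, the first one over `j` and the second one over `s` and `j`
  have h2 : ∀ s ∈ Finset.range P, ∑ j ∈ Finset.range J,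
      (lowWeight Y (a * q ^ s * (q ^ P : ℝ) ^ (j + 1)) -
        lowWeight Y (a * q ^ s * (q ^ P : ℝ) ^ j)) ≤ hullWeight Y := by
    intro s _
    rw [Finset.sum_range_sub fun j => lowWeight Y (a * q ^ s * (q ^ P : ℝ) ^ j)]
    have h3 := lowWeight_nonneg Y (a * q ^ s * (q ^ P : ℝ) ^ 0)
    have h4 := lowWeight_le_hullWeight Y (a * q ^ s * (q ^ P : ℝ) ^ J)
    linarith
  have h3 : ∑ s ∈ Finset.range P, ∑ j ∈ Finset.range J,
      (lowWeight Y (a * q ^ (s + 1) * (q ^ P : ℝ) ^ j / q) -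
        lowWeight Y (a * q ^ s * (q ^ P : ℝ) ^ j / q)) ≤ hullWeight Y := by
    rw [Finset.sum_comm]
    have h4 : ∀ j : ℕ, ∑ s ∈ Finset.range P,
        (lowWeight Y (a * q ^ (s + 1) * (q ^ P : ℝ) ^ j / q) -
          lowWeight Y (a * q ^ s * (q ^ P : ℝ) ^ j / q)) =
        lowWeight Y (a * (q ^ P : ℝ) ^ (j + 1) / q) - lowWeight Y (a * (q ^ P : ℝ) ^ j / q) := by
      intro j
      rw [Finset.sum_range_sub fun s => lowWeight Y (a * q ^ s * (q ^ P : ℝ) ^ j / q)]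
      congr 2 <;> ring_nf
    simp only [h4]
    rw [Finset.sum_range_sub fun j => lowWeight Y (a * (q ^ P : ℝ) ^ j / q)]
    have h5 := lowWeight_nonneg Y (a * (q ^ P : ℝ) ^ 0 / q)
    have h6 := lowWeight_le_hullWeight Y (a * (q ^ P : ℝ) ^ J / q)
    linarith
  refine (Finset.sum_le_sum fun s _ => Finset.sum_le_sum fun j _ => h1 s j).trans ?_
  simp only [← Finset.mul_sum, Finset.sum_add_distrib]
  have h5 := Finset.sum_le_sum h2
  rw [Finset.sum_const, Finset.card_range, nsmul_eq_mul] at h5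
  have h6 := mul_le_mul_of_nonneg_left h3 hr
  have h7 := mul_le_mul_of_nonneg_left hY (add_nonneg P.cast_nonneg hr)
  linarith

end DepotTree

/-- The base `q` and the number `P` of shifts: blocks of ratio `q ^ P` have bounded distances, and
the loss `q / (q - 1) / P` is small enough. -/
theorem exists_base_shifts {ε : ℝ} (hε : 0 < ε) (hε' : ε ≤ 1 / 2) : ∃ q P : ℕ, 2 ≤ q ∧ 0 < P ∧
    (q : ℝ) ^ P ≤ (1 / ε) ^ (1 / ε - 1) ∧ (P + q / (q - 1) : ℝ) ≤ (1 + 5 * ε) * P := by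
  obtain ⟨x, hx, rfl⟩ : ∃ x : ℝ, 0 < x ∧ ε = 1 / x := ⟨1 / ε, by positivity, by simp⟩
  have hx2 : 2 ≤ x := by
    rw [div_le_div_iff₀ hx two_pos] at hε'; linarith
  rw [one_div_one_div]
  -- Blocks of ratio `2` and a single shift lose `2`, which is enough for `1 / ε ≤ 5 / 2`. With ratio `3`,
  -- the loss is `3 / 2`, which is enough up to `10 / 3`. Beyond that, there is room between `2 / 5 * x`
  -- and `x - 1` for an integer `P` with `q = 2`.
  rcases le_total x (5 / 2) with h | h
  · refine ⟨2, 1, le_rfl, one_pos, ?_, ?_⟩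
    · have : x ^ (1 : ℝ) ≤ x ^ (x - 1) :=
        Real.rpow_le_rpow_of_exponent_le (by linarith) (by linarith)
      rw [Real.rpow_one] at this
      push_cast; linarith
    · have : 2 / 5 ≤ 1 / x := by rw [le_div_iff₀ hx]; linarith
      push_cast; norm_num; norm_num at this; linarith
  rcases le_total x (10 / 3) with h' | h'
  · refine ⟨3, 1, by norm_num, one_pos, ?_, ?_⟩
    · have h1 : (3 : ℝ) ≤ (5 / 2 : ℝ) ^ (3 / 2 : ℝ) := by
        rw [show (5 / 2 : ℝ) ^ (3 / 2 : ℝ) = √((5 / 2) ^ (3 : ℕ)) by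
          rw [Real.sqrt_eq_rpow, ← Real.rpow_natCast, ← Real.rpow_mul (by norm_num)]; norm_num]
        exact Real.le_sqrt_of_sq_le (by norm_num)
      have h2 : (5 / 2 : ℝ) ^ (3 / 2 : ℝ) ≤ x ^ (3 / 2 : ℝ) :=
        Real.rpow_le_rpow (by norm_num) h (by norm_num)
      have h3 : x ^ (3 / 2 : ℝ) ≤ x ^ (x - 1) :=
        Real.rpow_le_rpow_of_exponent_le (by linarith) (by linarith)
      push_cast; linarith
    · have : 3 / 10 ≤ 1 / x := by rw [le_div_iff₀ hx]; linarith
      push_cast; norm_num; norm_num at this; linarith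
  · have hP : 0 < ⌈2 / 5 * x⌉₊ := Nat.ceil_pos.2 (by positivity)
    refine ⟨2, ⌈2 / 5 * x⌉₊, le_rfl, hP, ?_, ?_⟩
    · have h1 := (Nat.ceil_lt_add_one (a := 2 / 5 * x) (by positivity)).le
      calc ((2 : ℕ) : ℝ) ^ ⌈2 / 5 * x⌉₊ ≤ x ^ ⌈2 / 5 * x⌉₊ := by push_cast; gcongr
        _ = x ^ ((⌈2 / 5 * x⌉₊ : ℕ) : ℝ) := (Real.rpow_natCast _ _).symm
        _ ≤ _ := Real.rpow_le_rpow_of_exponent_le (by linarith) (by linarith)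
    · have h1 := Nat.le_ceil (2 / 5 * x)
      have h2 : 2 ≤ 5 * (1 / x) * ⌈2 / 5 * x⌉₊ := by
        rw [mul_one_div, div_mul_eq_mul_div, le_div_iff₀ hx]; linarith
      push_cast; norm_num; norm_num at h2; linarith

/-! ### Instances and solutions as lists of numbers -/

theorem List.getD_ofFn_val {α : Type} {n : ℕ} (f : Fin n → α) (i : Fin n) (d : α) :
    (List.ofFn f).getD i d = f i := by simp [List.getD]

theorem List.map_range_eq_ofFn {α : Type} (n : ℕ) (g : ℕ → α) :
    (List.range n).map g = List.ofFn fun i : Fin n => g i := by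
  apply List.ext_getElem <;> simp

/-- The fraction `x` has a positive denominator and the value `q`. -/
def IsFrac (x : ℕ × ℕ) (q : ℚ≥0) : Prop := 0 < x.2 ∧ (x.1 : ℚ≥0) = q * x.2

theorem IsFrac.add {x y : ℕ × ℕ} {q r : ℚ≥0} (hx : IsFrac x q) (hy : IsFrac y r) :
    IsFrac (fracAdd x y) (q + r) := by
  refine ⟨Nat.mul_pos hx.1 hy.1, ?_⟩
  simp only [fracAdd]
  push_cast
  rw [hx.2, hy.2]; ring

theorem IsFrac.le_iff {x y : ℕ × ℕ} {q r : ℚ≥0} (hx : IsFrac x q) (hy : IsFrac y r) :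
    x.1 * y.2 ≤ y.1 * x.2 ↔ q ≤ r := by
  have h1 : (0 : ℚ≥0) < x.2 := by exact_mod_cast hx.1
  have h2 : (0 : ℚ≥0) < y.2 := by exact_mod_cast hy.1
  rw [← Nat.cast_le (α := ℚ≥0)]
  push_cast
  rw [hx.2, hy.2, mul_assoc, mul_assoc, mul_comm (y.2 : ℚ≥0), mul_le_mul_iff_left₀ (by positivity)]

theorem IsFrac.num_eq_zero {x : ℕ × ℕ} {q : ℚ≥0} (hx : IsFrac x q) : x.1 = 0 ↔ q = 0 := by
  have h1 : (x.2 : ℚ≥0) ≠ 0 := by exact_mod_cast hx.1.ne'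
  rw [← Nat.cast_eq_zero (R := ℚ≥0), hx.2, mul_eq_zero, or_iff_left h1]

theorem IsFrac.fracSum {α : Type} (l : List α) {f : α → ℕ × ℕ} {g : α → ℚ≥0}
    (h : ∀ a ∈ l, IsFrac (f a) (g a)) : IsFrac (fracSum (l.map f)) (l.map g).sum := by
  induction l using List.reverseRecOn with
  | nil => exact ⟨one_pos, by simp [_root_.fracSum]⟩
  | append_singleton l a ih =>
    have := (ih fun b hb => h b (by simp [hb])).add (h a (by simp))
    simpa [_root_.fracSum] using this

theorem le_fracHeight {l : List (ℕ × ℕ)} (h : ∀ d ∈ l, 0 < d.2) :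
    0 < fracHeight l ∧ ∀ d ∈ l, d.1 < fracHeight l ∧ d.2 ≤ fracHeight l := by
  induction l using List.reverseRecOn with
  | nil => simp [fracHeight]
  | append_singleton l x ih =>
    obtain ⟨h1, h2⟩ := ih fun d hd => h d (by simp [hd])
    have h3 := h x (by simp)
    have e : fracHeight (l ++ [x]) = fracHeight l * ((x.1 + 1) * x.2) := by simp [fracHeight]
    rw [e]
    have h4 : 0 < (x.1 + 1) * x.2 := by positivity
    refine ⟨by positivity, fun d hd => ?_⟩
    rcases List.mem_append.1 hd with hd | hd
    · have := Nat.le_mul_of_pos_right (fracHeight l) h4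
      have := h2 d hd
      omega
    · obtain rfl : d = x := by simpa using hd
      have := Nat.le_mul_of_pos_left ((d.1 + 1) * d.2) h1
      have := Nat.le_mul_of_pos_right (d.1 + 1) h3
      have := Nat.le_mul_of_pos_left d.2 (Nat.add_pos_right d.1 one_pos)
      omega

theorem sum_map_geomList {M : Type} [AddCommMonoid M] (a Q : ℕ) (l : List ℕ) (f : ℕ → M) :
    ((geomList a Q l).map f).sum = ∑ j ∈ Finset.range l.length, f (a * Q ^ j) := by
  rw [geomList, foldl_geomList]
  simp only [List.map_reverse, List.map_map, List.sum_reverse]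
  induction l.length with
  | zero => simp
  | succ n ih => rw [List.range_succ, Finset.sum_range_succ, List.map_append, List.sum_append, ih]; simp

namespace DepotTree

open SimpleGraph

open Classical in
/-- Entry of the weighted adjacency matrix; `(0, 0)` if `u` and `v` are not adjacent. -/
noncomputable def rawEntry (T : DepotTree) (u v : Fin T.n) : ℕ × ℕ :=
  if T.graph.Adj u v then ((T.weight s(u, v)).num, (T.weight s(u, v)).den) else (0, 0)

/-- The weighted adjacency matrix. -/
noncomputable def rawMatrix (T : DepotTree) : List (List (ℕ × ℕ)) :=
  List.ofFn fun u => List.ofFn fun v => T.rawEntry u v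

variable {T : DepotTree}

theorem length_rawMatrix : T.rawMatrix.length = T.n := by simp [rawMatrix]

theorem matEntry_rawMatrix (u v : Fin T.n) : matEntry T.rawMatrix u v = T.rawEntry u v := by
  rw [matEntry, rawMatrix, List.getD_ofFn_val, List.getD_ofFn_val]

theorem rawEntry_den_pos {u v : Fin T.n} : 0 < (T.rawEntry u v).2 ↔ T.graph.Adj u v := by
  unfold rawEntry; split_ifs with h <;> simp [h, NNRat.den_pos]

theorem isFrac_rawEntry {u v : Fin T.n} (h : T.graph.Adj u v) :
    IsFrac (T.rawEntry u v) (T.weight s(u, v)) := by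
  rw [rawEntry, if_pos h]
  refine ⟨NNRat.den_pos _, ?_⟩
  exact (NNRat.mul_den_eq_num _).symm

theorem isFrac_walkFrac {u v : Fin T.n} (p : T.graph.Walk u v) :
    IsFrac (walkFrac T.rawMatrix (p.support.map Fin.val)) (T.walkWeight p) := by
  have key : ∀ {u v : Fin T.n} (p : T.graph.Walk u v) (x : ℕ × ℕ) (q : ℚ≥0), IsFrac x q →
      IsFrac ((p.support.tail.map Fin.val).foldl (fun (s : ℕ × ℕ × ℕ) v =>
        (v, fracAdd s.2 (matEntry T.rawMatrix s.1 v))) (u.val, x)).2 (q + T.walkWeight p) := by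
    intro u v p
    induction p with
    | nil => intro x q h; simpa [walkWeight] using h
    | @cons u v w h p ih =>
      intro x q hx
      have := ih _ _ (hx.add (isFrac_rawEntry h))
      rw [Walk.support_cons, List.tail_cons, ← Walk.cons_tail_support p, List.map_cons,
        List.foldl_cons]
      simp only [matEntry_rawMatrix]
      convert this using 1
      simp [walkWeight, add_assoc]
  have := key p (0, 1) 0 ⟨one_pos, by simp⟩
  rw [zero_add] at this
  rw [walkFrac, ← Walk.cons_tail_support p]
  exact this

/-- The path from `v` to the root as a list of numbers. -/
noncomputable def pathList (T : DepotTree) (v : Fin T.n) : List ℕ :=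
  ((T.rootPath v).support.map Fin.val).reverse

theorem pathList_ne_nil (v : Fin T.n) : T.pathList v ≠ [] := by simp [pathList]

theorem pathList_concat {u v : Fin T.n} {h : T.graph.Adj u v}
    (hp : T.rootPath v = (T.rootPath u).concat h) : T.pathList v = v.val :: T.pathList u := by
  rw [pathList, hp, Walk.support_concat]; simp [pathList]

theorem pathList_root : T.pathList T.root = [T.root.val] := by simp [pathList, rootPath_root]

/-- After `k` rounds, the paths with at most `k` edges have been found. -/
theorem foldl_stepPaths {α : Type} (l : List α) :
    l.foldl (fun pts _ => stepPaths T.rawMatrix pts) (initPaths T.rawMatrix T.root) =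
      List.ofFn fun v => if (T.rootPath v).length ≤ l.length then T.pathList v else [] := by
  induction l using List.reverseRecOn with
  | nil =>
    rw [List.foldl_nil, initPaths, length_rawMatrix, List.map_range_eq_ofFn]
    congr 1; funext v
    by_cases hv : v = T.root
    · subst hv; simp [rootPath_root, pathList_root]
    · have := length_rootPath hv
      rw [if_neg (fun h => hv (Fin.ext h)), if_neg (by rw [List.length_nil]; omega)]
  | append_singleton l a ih =>
    rw [List.foldl_append, List.foldl_cons, List.foldl_nil, ih, stepPaths, length_rawMatrix,
      List.map_range_eq_ofFn]
    congr 1; funext v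
    simp only [List.getD_ofFn_val, List.map_range_eq_ofFn, matEntry_rawMatrix,
      List.length_append, List.length_singleton]
    set k := l.length
    by_cases hk : (T.rootPath v).length ≤ k
    · rw [if_neg (by rw [if_pos hk]; exact pathList_ne_nil v), if_pos hk, if_pos (by omega)]
    rw [if_pos (if_neg hk)]
    -- every candidate for a path from `v` is the path from `v`
    have hc : ∀ u, T.graph.Adj u v → (T.rootPath u).length ≤ k →
        (T.rootPath v).length = (T.rootPath u).length + 1 ∧ T.pathList v = v.val :: T.pathList u := by
      intro u h hu
      rcases rootPath_adj h with h' | h'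
      · exact ⟨by rw [h', Walk.length_concat], pathList_concat h'⟩
      · rw [h', Walk.length_concat] at hu; omega
    generalize hL : List.flatten _ = L
    have hmem : ∀ p, p ∈ L ↔ ∃ u, T.graph.Adj u v ∧ (T.rootPath u).length ≤ k ∧
        p = v.val :: T.pathList u := by
      intro p
      rw [← hL]
      simp only [List.mem_flatten, List.mem_ofFn]
      constructor
      · rintro ⟨_, ⟨u, rfl⟩, hp⟩
        split_ifs at hp with h1 h2 h2
        · exact ⟨u, rawEntry_den_pos.1 h2.1, h1, by simpa using hp⟩
        · simp at hp
        · exact absurd rfl h2.2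
        · simp at hp
      · rintro ⟨u, h1, h2, rfl⟩
        refine ⟨_, ⟨u, rfl⟩, ?_⟩
        simp [rawEntry_den_pos.2 h1, h2, pathList_ne_nil]
    by_cases hk' : (T.rootPath v).length ≤ k + 1
    · rw [if_pos hk']
      have hv : v ≠ T.root := by rintro rfl; simp [rootPath_root] at hk
      have h1 := length_rootPath hv
      have h2 := (hmem _).2 ⟨_, parent_adj hv, by omega, rfl⟩
      cases L with
      | nil => simp at h2
      | cons p L =>
        obtain ⟨u, hu, hu', rfl⟩ := (hmem p).1 (by simp)
        exact (hc u hu hu').2.symm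
    · rw [if_neg hk']
      cases L with
      | nil => rfl
      | cons p L =>
        obtain ⟨u, hu, hu', rfl⟩ := (hmem p).1 (by simp)
        have := (hc u hu hu').1
        omega

theorem rootPaths_rawMatrix : rootPaths T.rawMatrix T.root = List.ofFn T.pathList := by
  rw [rootPaths, foldl_stepPaths]
  congr 1; funext v
  have := (T.isPath_rootPath v).length_lt
  rw [Fintype.card_fin] at this
  rw [if_pos (by rw [length_rawMatrix]; exact this.le)]

/-- The distance of `v` as a fraction, as it is computed from the weight matrix. -/
noncomputable def distFrac (T : DepotTree) (v : Fin T.n) : ℕ × ℕ :=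
  walkFrac T.rawMatrix (T.pathList v)

theorem rootDists_rawMatrix : rootDists T.rawMatrix T.root = List.ofFn T.distFrac := by
  rw [rootDists, rootPaths_rawMatrix, List.map_ofFn]; rfl

theorem isFrac_distFrac (v : Fin T.n) : IsFrac (T.distFrac v) (T.dist v) := by
  have := isFrac_walkFrac (T.rootPath v).reverse
  rwa [walkWeight_reverse, Walk.support_reverse, List.map_reverse] at this

/-- A bound for the distances and for the reciprocals of the nonzero distances. -/
noncomputable def distHeight (T : DepotTree) : ℕ := fracHeight (rootDists T.rawMatrix T.root)

theorem distHeight_pos : 0 < T.distHeight :=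
  (le_fracHeight fun d hd => by
    rw [rootDists_rawMatrix] at hd
    obtain ⟨v, rfl⟩ := List.mem_ofFn.1 hd
    exact (isFrac_distFrac v).1).1

theorem dist_mem_Ico (v : Fin T.n) (hv : T.dist v ≠ 0) :
    (1 / T.distHeight : ℝ) ≤ T.dist v ∧ (T.dist v : ℝ) < T.distHeight := by
  have h0 := distHeight_pos (T := T)
  obtain ⟨h1, h2⟩ := (le_fracHeight (l := rootDists T.rawMatrix T.root) fun d hd => by
    rw [rootDists_rawMatrix] at hd
    obtain ⟨v, rfl⟩ := List.mem_ofFn.1 hd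
    exact (isFrac_distFrac v).1).2 (T.distFrac v) (by
      rw [rootDists_rawMatrix]; exact List.mem_ofFn.2 ⟨v, rfl⟩)
  have h := isFrac_distFrac v
  have h3 : 1 ≤ (T.distFrac v).1 := by
    rw [Nat.one_le_iff_ne_zero, Ne, h.num_eq_zero]; exact hv
  have h4 : ((T.distFrac v).1 : ℝ) = T.dist v * (T.distFrac v).2 := by exact_mod_cast h.2
  have h5 : (1 : ℝ) ≤ (T.distFrac v).2 := by exact_mod_cast h.1
  have h6 : (0 : ℝ) ≤ T.dist v := by positivity
  have h7 : (1 : ℝ) ≤ (T.distFrac v).1 := by exact_mod_cast h3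
  have h8 : ((T.distFrac v).1 : ℝ) < T.distHeight := by exact_mod_cast h1
  have h9 : ((T.distFrac v).2 : ℝ) ≤ T.distHeight := by exact_mod_cast h2
  constructor
  · rw [div_le_iff₀ (by exact_mod_cast h0)]
    nlinarith
  · nlinarith

/-- A tour as a pair of lists of numbers. -/
def rawTour (t : T.Tour) : List ℕ × List ℕ := (t.walk.support.map Fin.val, List.ofFn t.load)

/-- A solution as a list of multiplicities and tours. -/
def rawPlan (S : T.Plan) : List (ℕ × List ℕ × List ℕ) := S.map fun e => (e.1, rawTour e.2)

theorem encodePlan_eq (S : T.Plan) : CVRP.encodePlan S = enc (rawPlan S) := by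
  simp only [CVRP.encodePlan, CVRP.encodeTour, enc, rawPlan, rawTour, List.map_map, List.map_ofFn,
    Function.comp_def, List.bind_eq_flatMap, List.pure_def,
    ← List.map_eq_flatMap]

theorem isFrac_planFrac (S : T.Plan) : IsFrac (planFrac T.rawMatrix (rawPlan S)) S.cost := by
  rw [planFrac, rawPlan, List.map_map, Plan.cost]
  refine IsFrac.fracSum S fun e _ => ?_
  have := isFrac_walkFrac e.2.walk
  refine ⟨this.1, ?_⟩
  have h := this.2
  simp only [Function.comp_apply, rawTour]
  push_cast
  rw [h, mul_assoc]

namespace Plan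

theorem cost_append (S S' : T.Plan) : cost (S ++ S') = cost S + cost S' := by simp [cost]

theorem served_append (S S' : T.Plan) (v : Fin T.n) :
    served (S ++ S') v = served S v + served S' v := by simp [served]

theorem cost_flatten (L : List T.Plan) : cost L.flatten = (L.map cost).sum := by
  induction L with
  | nil => rfl
  | cons S L ih => rw [List.flatten_cons, List.map_cons, List.sum_cons, ← ih]; exact cost_append _ _

theorem served_flatten (L : List T.Plan) (v : Fin T.n) :
    served L.flatten v = (L.map fun S => served S v).sum := by
  induction L with
  | nil => rfl
  | cons S L ih =>
    rw [List.flatten_cons, List.map_cons, List.sum_cons, ← ih]; exact served_append _ _ _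

end Plan

/-- A tour on the path to `v` and back that serves the amount `d` at `v`. -/
noncomputable def pathTour (T : DepotTree) (v : Fin T.n) (d : ℕ) : T.Tour where
  walk := (T.rootPath v).append (T.rootPath v).reverse
  load u := if u = v then d else 0
  load_support u hu := by
    obtain rfl : u = v := by by_contra h; simp [h] at hu
    simp [Walk.mem_support_append_iff]

/-- Tours that serve the given demands of the vertices at distance zero. -/
noncomputable def zeroPlan (T : DepotTree) (ver : Version) (d : Fin T.n → ℕ) : T.Plan :=
  (List.ofFn fun v => if T.dist v = 0 then
    [(tourMult ver (d v), T.pathTour v (tourLoad ver (d v)))] else []).flatten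

theorem rawPlan_zeroPlan (ver : Version) (d : Fin T.n → ℕ) : rawPlan (T.zeroPlan ver d) =
    zeroTours ver (rootPaths T.rawMatrix T.root) (rootDists T.rawMatrix T.root) (List.ofFn d) := by
  rw [rawPlan, zeroPlan, List.map_flatten, List.map_ofFn, zeroTours, List.length_ofFn,
    List.map_range_eq_ofFn]
  congr 2; funext v
  simp only [Function.comp_apply, rootDists_rawMatrix, rootPaths_rawMatrix, List.getD_ofFn_val,
    (isFrac_distFrac v).num_eq_zero, List.map_range_eq_ofFn]
  split_ifs
  · simp only [List.map_cons, List.map_nil, rawTour, pathTour, Fin.ext_iff, pathList,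
      List.reverse_reverse, Walk.support_append, Walk.support_reverse, List.map_append, List.map_tail,
      List.map_reverse]
  · rfl

theorem cost_zeroPlan (ver : Version) (d : Fin T.n → ℕ) : (T.zeroPlan ver d).cost = 0 := by
  rw [zeroPlan, Plan.cost_flatten, List.map_ofFn]
  refine List.sum_eq_zero fun x hx => ?_
  obtain ⟨v, rfl⟩ := List.mem_ofFn.1 hx
  simp only [Function.comp_apply]
  split_ifs with h
  · rw [dist_eq] at h
    simp [Plan.cost, pathTour, walkWeight_append, walkWeight_reverse, h]
  · rfl

theorem served_zeroPlan (ver : Version) (d : Fin T.n → ℕ) (v : Fin T.n) :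
    (T.zeroPlan ver d).served v = if T.dist v = 0 then d v else 0 := by
  rw [zeroPlan, Plan.served_flatten, List.map_ofFn, List.sum_ofFn, Finset.sum_eq_single v]
  · simp only [Function.comp_apply]
    split_ifs with h
    · cases ver <;> simp [Plan.served, pathTour, tourMult, tourLoad]
    · rfl
  · intro u _ huv
    simp only [Function.comp_apply]
    split_ifs with h
    · simp [Plan.served, pathTour, huv.symm]
    · rfl
  · simp

theorem mem_zeroPlan {ver : Version} {d : Fin T.n → ℕ} {e : ℕ × T.Tour}
    (he : e ∈ T.zeroPlan ver d) : ∃ v, e.2 = T.pathTour v (tourLoad ver (d v)) := by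
  obtain ⟨_, h, he⟩ := List.mem_flatten.1 he
  obtain ⟨v, rfl⟩ := List.mem_ofFn.1 h
  split_ifs at he
  · exact ⟨v, by rw [List.mem_singleton.1 he]⟩
  · simp at he

end DepotTree

namespace CVRP

theorem encode_eq (I : CVRP) : I.encode =
    enc (I.tree.root.val, I.capacity, List.ofFn I.demand, I.tree.rawMatrix) := by
  have : ∀ u v, enc (I.tree.rawEntry u v) = encodeEntry I.tree u v := fun u v => by
    unfold DepotTree.rawEntry encodeEntry; split_ifs <;> rfl
  simp only [encode, enc, DepotTree.rawMatrix, List.map_ofFn, Function.comp_def]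
  simp only [enc] at this
  simp only [this]

/-- The instance in which only the demands at distance at least `a` and less than `Q * a` are
kept; `a` is given as a fraction. -/
noncomputable abbrev mask (I : CVRP) (Q : ℕ) (a : ℕ × ℕ) : CVRP where
  tree := I.tree
  demand v := if a.1 * (I.tree.distFrac v).2 ≤ (I.tree.distFrac v).1 * a.2 ∧
    (I.tree.distFrac v).1 * a.2 < Q * a.1 * (I.tree.distFrac v).2 then I.demand v else 0
  capacity := I.capacity

theorem ofFn_mask_demand (I : CVRP) (Q : ℕ) (a : ℕ × ℕ) : List.ofFn (I.mask Q a).demand =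
    maskDemands (rootDists I.tree.rawMatrix I.tree.root) (List.ofFn I.demand) Q a := by
  rw [maskDemands, List.length_ofFn, List.map_range_eq_ofFn]
  simp only [DepotTree.rootDists_rawMatrix]
  congr 1; funext v
  rw [List.getD_ofFn_val I.tree.distFrac v, List.getD_ofFn_val]

open Classical in
/-- Comparing fractions is comparing distances. -/
theorem mask_demand (I : CVRP) (Q : ℕ) {a b : ℕ} (hb : 0 < b) (v : Fin I.tree.n) :
    (I.mask Q (a, b)).demand v = if (a / b : ℝ) ≤ I.tree.dist v ∧
      (I.tree.dist v : ℝ) < Q * (a / b) then I.demand v else 0 := by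
  have h := DepotTree.isFrac_distFrac v
  have h1 : (0 : ℝ) < (I.tree.distFrac v).2 := by exact_mod_cast h.1
  have h2 : ((I.tree.distFrac v).1 : ℝ) = I.tree.dist v * (I.tree.distFrac v).2 := by
    exact_mod_cast h.2
  have hb' : (0 : ℝ) < b := by exact_mod_cast hb
  refine if_congr (and_congr ?_ ?_) rfl rfl
  · rw [← Nat.cast_le (α := ℝ), div_le_iff₀ hb']
    push_cast
    rw [h2, mul_right_comm, mul_le_mul_iff_left₀ h1]
  · rw [← Nat.cast_lt (α := ℝ), mul_div_assoc', lt_div_iff₀ hb']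
    push_cast
    rw [h2, mul_right_comm, mul_lt_mul_iff_left₀ h1]

theorem mask_demand_eq_zero_or (I : CVRP) (Q : ℕ) (a : ℕ × ℕ) (v : Fin I.tree.n) :
    (I.mask Q a).demand v = 0 ∨ (I.mask Q a).demand v = I.demand v := by
  dsimp only; split_ifs <;> simp

theorem IsInstance.mask {I : CVRP} {ver : Version} (h : I.IsInstance ver) (Q : ℕ) (a : ℕ × ℕ) :
    (I.mask Q a).IsInstance ver := by
  have h1 := I.mask_demand_eq_zero_or Q a
  cases ver with
  | unitDemand =>
    refine ⟨h.1, h.2.1, fun v hv => ?_⟩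
    have hv : 0 < (I.mask Q a).demand v := hv
    rcases h1 v with h2 | h2
    · omega
    · rw [h2] at hv ⊢; exact h.2.2 v hv
  | splittable => exact h
  | unsplittable =>
    refine ⟨h.1, fun v => ?_⟩
    have := h.2 v
    change (I.mask Q a).demand v ≤ I.capacity
    rcases h1 v with h2 | h2 <;> omega

/-- For `a = 0` this holds because no demand is kept: the range `[0, 0)` is empty. In particular no
terminal at distance zero remains, which the condition would not allow. -/
theorem boundedDistances_mask (I : CVRP) {ε : ℝ} {Q b : ℕ} (a : ℕ) (hb : 0 < b)
    (hQ : (Q : ℝ) ≤ (1 / ε) ^ (1 / ε - 1)) : BoundedDistances ε (I.mask Q (a, b)) := by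
  intro (u : Fin I.tree.n) (v : Fin I.tree.n) hu hv
  have hu : 0 < (I.mask Q (a, b)).demand u := hu
  have hv : 0 < (I.mask Q (a, b)).demand v := hv
  rw [mask_demand I Q hb] at hu hv
  split_ifs at hu hv with h1 h2
  · have h3 : (0 : ℝ) ≤ I.tree.dist v := by positivity
    calc (I.tree.dist u : ℝ) < Q * (a / b) := h1.2
      _ ≤ Q * I.tree.dist v := by gcongr; exact h2.1
      _ ≤ _ := by gcongr
  all_goals omega

end CVRP

/-! ### Solving the groups of one shift -/

namespace CVRP

variable (I : CVRP)

/-- The numerators of the lower ends of the groups for the shift `s`, for the common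
denominator `distHeight * q ^ P`. -/
noncomputable def lowerEnds (q P s : ℕ) : List ℕ :=
  geomList (q ^ s) (q ^ P)
    (List.replicate (I.tree.distHeight * I.tree.distHeight * q ^ P).size 0)

/-- The instance of the group with lower end `a / (distHeight * q ^ P)`. -/
noncomputable abbrev group (q P a : ℕ) : CVRP := I.mask (q ^ P) (a, I.tree.distHeight * q ^ P)

/-- The union of solutions of all groups for the shift `s`. -/
noncomputable def shiftPlan (q P : ℕ) (plan : ℕ → I.tree.Plan) (s : ℕ) : I.tree.Plan :=
  ((I.lowerEnds q P s).map plan).flatten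

variable {I}

/-- At most one of consecutive intervals contains `d`. -/
theorem sum_consecutive {A : ℕ → ℝ} (hA : Monotone A) (d : ℝ) (D J : ℕ) :
    ∑ j ∈ Finset.range J, (if A j ≤ d ∧ d < A (j + 1) then D else 0) =
      if A 0 ≤ d ∧ d < A J then D else 0 := by
  induction J with
  | zero => rw [if_neg (fun h => (h.1.trans_lt h.2).ne rfl)]; simp
  | succ J ih =>
    rw [Finset.sum_range_succ, ih]
    have h1 := hA J.le_succ
    have h2 := hA J.zero_le
    by_cases h3 : A 0 ≤ d <;> by_cases h4 : d < A J
    · simp [h3, h4, h4.trans_le h1, not_le.2 h4]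
    · simp [h3, h4, not_lt.1 h4]
    · simp [h3, not_le.2 h4]
    · simp [h3, mt h2.trans h3]

theorem group_demand {q : ℕ} (hq : 2 ≤ q) (P s j : ℕ) (v : Fin I.tree.n) :
    (I.group q P (q ^ s * (q ^ P) ^ j)).demand v = open Classical in
      if 1 / (I.tree.distHeight * q ^ P : ℝ) * q ^ s * (q ^ P : ℝ) ^ j ≤ I.tree.dist v ∧
        (I.tree.dist v : ℝ) < q ^ P * (1 / (I.tree.distHeight * q ^ P : ℝ) * q ^ s * (q ^ P : ℝ) ^ j)
      then I.demand v else 0 := by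
  have hH := DepotTree.distHeight_pos (T := I.tree)
  rw [mask_demand _ _ (by positivity)]
  have : ((q ^ s * (q ^ P) ^ j : ℕ) : ℝ) / (I.tree.distHeight * q ^ P : ℕ) =
      1 / (I.tree.distHeight * q ^ P : ℝ) * q ^ s * (q ^ P : ℝ) ^ j := by
    push_cast; ring
  rw [this, Nat.cast_pow]

/-- Every demand at a positive distance lies in exactly one of the groups. -/
theorem sum_group_demand {q P s : ℕ} (hq : 2 ≤ q) (hs : s < P) (v : Fin I.tree.n) :
    ((I.lowerEnds q P s).map fun a => (I.group q P a).demand v).sum =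
      if I.tree.dist v = 0 then 0 else I.demand v := by
  classical
  have hH : (0 : ℝ) < I.tree.distHeight := by exact_mod_cast DepotTree.distHeight_pos
  have hq1 : (1 : ℝ) ≤ q := by exact_mod_cast one_le_two.trans hq
  rw [lowerEnds, sum_map_geomList, List.length_replicate]
  set J := (I.tree.distHeight * I.tree.distHeight * q ^ P).size
  set A : ℕ → ℝ := fun j => 1 / (I.tree.distHeight * q ^ P : ℝ) * q ^ s * (q ^ P : ℝ) ^ j
  have hA : ∀ j, (q ^ P : ℝ) * A j = A (j + 1) := fun j => by simp only [A]; ring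
  have hmono : Monotone A := by
    intro i j hij
    simp only [A]
    gcongr
    exact one_le_pow₀ hq1
  have : ∀ j ∈ Finset.range J, (I.group q P (q ^ s * (q ^ P) ^ j)).demand v =
      if A j ≤ I.tree.dist v ∧ (I.tree.dist v : ℝ) < A (j + 1) then I.demand v else 0 := fun j _ => by
    rw [group_demand hq, ← hA]
  rw [Finset.sum_congr rfl this, sum_consecutive hmono]
  by_cases hv : I.tree.dist v = 0
  · have : 0 < A 0 := by simp only [A]; positivity
    rw [if_pos hv, if_neg fun h => by rw [hv] at h; exact absurd h.1 (by simpa using this)]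
  · obtain ⟨h1, h2⟩ := DepotTree.dist_mem_Ico v hv
    have hlo : A 0 ≤ 1 / I.tree.distHeight := by
      have : (q : ℝ) ^ s ≤ q ^ P := pow_le_pow_right₀ hq1 hs.le
      simp only [A, pow_zero, mul_one]
      rw [div_mul_eq_mul_div, one_mul, div_le_div_iff₀ (by positivity) hH]
      nlinarith
    -- there are as many groups as bits in `distHeight ^ 2 * q ^ P`, hence they reach up to `distHeight`
    have hhi : I.tree.distHeight ≤ A J := by
      have h3 : I.tree.distHeight * I.tree.distHeight * q ^ P ≤ (q ^ P) ^ J := by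
        refine (Nat.lt_size_self _).le.trans (Nat.pow_le_pow_left ?_ _)
        exact hq.trans (Nat.le_self_pow (by omega) q)
      have h4 : (I.tree.distHeight * I.tree.distHeight * q ^ P : ℝ) ≤ (q ^ P : ℝ) ^ J := by
        exact_mod_cast h3
      have h5 : (1 : ℝ) ≤ q ^ s := one_le_pow₀ hq1
      simp only [A]
      rw [div_mul_eq_mul_div, one_mul, div_mul_eq_mul_div, le_div_iff₀ (by positivity), ← mul_assoc]
      exact h4.trans (le_mul_of_one_le_left (by positivity) h5)
    rw [if_neg hv, if_pos ⟨hlo.trans h1, h2.trans_le hhi⟩]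

/-- Solutions of the groups of one shift and the tours of cost zero make up a solution. -/
theorem feasible_shiftPlan {ver : Version} (hI : I.IsInstance ver) {q P s : ℕ} (hq : 2 ≤ q)
    (hs : s < P) {plan : ℕ → I.tree.Plan} (hplan : ∀ a, (I.group q P a).Feasible ver (plan a)) :
    I.Feasible ver (I.shiftPlan q P plan s ++ I.tree.zeroPlan ver I.demand) := by
  have hmem : ∀ e ∈ I.shiftPlan q P plan s, ∃ a, e ∈ plan a := by
    intro e he
    obtain ⟨_, h, he⟩ := List.mem_flatten.1 he
    obtain ⟨a, _, rfl⟩ := List.mem_map.1 h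
    exact ⟨a, he⟩
  refine ⟨fun e he => ?_, fun v => ?_, fun hver e he v => ?_⟩
  · rcases List.mem_append.1 he with he | he
    · obtain ⟨a, ha⟩ := hmem e he
      exact (hplan a).capacity_le e ha
    · obtain ⟨v, hv⟩ := DepotTree.mem_zeroPlan he
      rw [hv]
      simp only [DepotTree.pathTour, Finset.sum_ite_eq', Finset.mem_univ, if_true]
      cases ver with
      | unitDemand => exact hI.1
      | splittable => exact hI
      | unsplittable => exact hI.2 v
  · rw [DepotTree.Plan.served_append, shiftPlan, DepotTree.Plan.served_flatten, List.map_map,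
      DepotTree.served_zeroPlan]
    have : ((I.lowerEnds q P s).map ((fun S => DepotTree.Plan.served S v) ∘ plan)) =
        (I.lowerEnds q P s).map fun a => (I.group q P a).demand v :=
      List.map_congr_left fun a _ => (hplan a).served_eq v
    rw [this, sum_group_demand hq hs]
    split_ifs <;> simp
  · rcases List.mem_append.1 he with he | he
    · obtain ⟨a, ha⟩ := hmem e he
      rcases (hplan a).unsplit hver e ha v with h | h
      · exact .inl h
      · rw [h]; exact I.mask_demand_eq_zero_or _ _ v
    · obtain ⟨u, hu⟩ := DepotTree.mem_zeroPlan he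
      subst hver
      rw [hu]
      simp only [DepotTree.pathTour, tourLoad]
      by_cases h : v = u <;> simp [h]

theorem cost_map_tours {T : DepotTree} (S : T.Plan) (f : T.Tour → T.Tour) :
    (DepotTree.Plan.cost (T := T) (S.map fun e => (e.1, f e.2)) : ℝ) =
      (S.map fun e => (e.1 : ℝ) * T.walkWeight (f e.2).walk).sum := by
  induction S with
  | nil => simp [DepotTree.Plan.cost]
  | cons e S ih =>
    simp only [DepotTree.Plan.cost, List.map_cons, List.sum_cons, NNRat.cast_add] at ih ⊢
    rw [ih]; push_cast; rfl

/-- Approximate solutions of the groups, summed over all shifts, compared with a solution of the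
whole instance. -/
theorem sum_cost_shiftPlan_le {ver : Version} {q P : ℕ} (hq : 2 ≤ q) {ρ : ℝ} (hρ : 0 ≤ ρ)
    {plan : ℕ → I.tree.Plan}
    (hplan : ∀ a, ∀ S' : I.tree.Plan, (I.group q P a).Feasible ver S' →
      ((plan a).cost : ℝ) ≤ ρ * (S'.cost : ℝ))
    {S : I.tree.Plan} (hS : I.Feasible ver S) :
    ∑ s ∈ Finset.range P, ((I.shiftPlan q P plan s).cost : ℝ) ≤
      ρ * ((P + q / (q - 1)) * S.cost) := by
  classical
  have hH : (0 : ℝ) < I.tree.distHeight := by exact_mod_cast DepotTree.distHeight_pos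
  have hq0 : (0 : ℝ) < q := by exact_mod_cast two_pos.trans_le hq
  set J := (I.tree.distHeight * I.tree.distHeight * q ^ P).size
  choose t hload ht using fun t : I.tree.Tour => DepotTree.exists_split_tours t
    (a := 1 / (I.tree.distHeight * q ^ P : ℝ)) (by positivity) hq P J
  have hfeas : ∀ s j, (I.group q P (q ^ s * (q ^ P) ^ j)).Feasible ver
      (S.map fun e => (e.1, t e.2 s j)) := by
    intro s j
    refine ⟨fun e he => ?_, fun v => ?_, fun hver e he v => ?_⟩
    · obtain ⟨e, he', rfl⟩ := List.mem_map.1 he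
      refine le_trans (Finset.sum_le_sum fun v _ => ?_) (hS.capacity_le e he')
      rw [hload]; split_ifs <;> simp
    · have h := hS.served_eq v
      rw [group_demand hq]
      simp only [DepotTree.Plan.served, List.map_map, Function.comp_def, hload]
      split_ifs
      · exact h
      · simp
    · obtain ⟨e, he', rfl⟩ := List.mem_map.1 he
      rw [group_demand hq, hload]
      split_ifs
      · exact hS.unsplit hver e he' v
      · exact .inl rfl
  have hcost : ∀ s, ((I.shiftPlan q P plan s).cost : ℝ) ≤ ρ * ∑ j ∈ Finset.range J,
      (S.map fun e => (e.1 : ℝ) * I.tree.walkWeight (t e.2 s j).walk).sum := by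
    intro s
    rw [shiftPlan, DepotTree.Plan.cost_flatten, List.map_map, lowerEnds, sum_map_geomList,
      List.length_replicate, Finset.mul_sum]
    push_cast
    refine Finset.sum_le_sum fun j _ => ?_
    rw [← cost_map_tours S fun e => t e s j]
    exact hplan _ _ (hfeas s j)
  have hsum : ∀ L : I.tree.Plan, ∑ s ∈ Finset.range P, ∑ j ∈ Finset.range J,
      (L.map fun e => (e.1 : ℝ) * I.tree.walkWeight (t e.2 s j).walk).sum ≤
        (P + q / (q - 1)) * (L.cost : ℝ) := by
    intro L
    induction L with
    | nil => simp [DepotTree.Plan.cost]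
    | cons e L ih =>
      have h1 : (DepotTree.Plan.cost (e :: L) : ℝ) =
          e.1 * I.tree.walkWeight e.2.walk + DepotTree.Plan.cost L := by
        simp [DepotTree.Plan.cost]
      simp only [List.map_cons, List.sum_cons, Finset.sum_add_distrib, ← Finset.mul_sum]
      rw [h1]
      have h2 := mul_le_mul_of_nonneg_left (ht e.2) (Nat.cast_nonneg (α := ℝ) e.1)
      linarith
  calc _ ≤ _ := Finset.sum_le_sum fun s _ => hcost s
    _ ≤ _ := by
      rw [← Finset.mul_sum]
      exact mul_le_mul_of_nonneg_left (hsum S) hρ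

/-- The cheapest one of the first `k + 1` of the solutions `c 0, c 1, …`, as found by comparing
fractions. -/
noncomputable def cheapest {T : DepotTree} (c : ℕ → T.Plan) : ℕ → T.Plan
  | 0 => c 0
  | k + 1 =>
    if (planFrac T.rawMatrix (DepotTree.rawPlan (c (k + 1)))).1 *
        (planFrac T.rawMatrix (DepotTree.rawPlan (cheapest c k))).2 ≤
      (planFrac T.rawMatrix (DepotTree.rawPlan (cheapest c k))).1 *
        (planFrac T.rawMatrix (DepotTree.rawPlan (c (k + 1)))).2
    then c (k + 1) else cheapest c k

theorem cheapest_spec {T : DepotTree} (c : ℕ → T.Plan) (k : ℕ) :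
    (∃ s ≤ k, cheapest c k = c s) ∧ ∀ s ≤ k, (cheapest c k).cost ≤ (c s).cost := by
  induction k with
  | zero => exact ⟨⟨0, le_rfl, rfl⟩, fun s hs => by rw [Nat.le_zero.1 hs]; rfl⟩
  | succ k ih =>
    obtain ⟨⟨s, hs, h1⟩, h2⟩ := ih
    rw [cheapest]
    split_ifs with h <;>
    rw [(DepotTree.isFrac_planFrac _).le_iff (DepotTree.isFrac_planFrac _)] at h
    · refine ⟨⟨k + 1, le_rfl, rfl⟩, fun u hu => ?_⟩
      rcases Nat.le_succ_iff.1 hu with hu | rfl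
      · exact h.trans (h2 u hu)
      · exact le_rfl
    · refine ⟨⟨s, hs.trans k.le_succ, h1⟩, fun u hu => ?_⟩
      rcases Nat.le_succ_iff.1 hu with hu | rfl
      · exact h2 u hu
      · exact (not_le.1 h).le

end CVRP

/-! ### The algorithm -/

noncomputable instance : ValCode CVRP := ⟨CVRP.encode⟩

namespace PolyTime

variable {P : CVRP → Prop}

theorem instance_data : PolyTime fun I : {I : CVRP // P I} =>
    (I.1.tree.root.val, I.1.capacity, List.ofFn I.1.demand, I.1.tree.rawMatrix) :=
  id.of_enc_eq fun I => (I.1.encode_eq).symm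

@[fun_prop]
theorem root : PolyTime fun I : {I : CVRP // P I} => I.1.tree.root.val := instance_data.fst

@[fun_prop]
theorem capacity : PolyTime fun I : {I : CVRP // P I} => I.1.capacity := instance_data.snd.fst

@[fun_prop]
theorem demand : PolyTime fun I : {I : CVRP // P I} => List.ofFn I.1.demand :=
  instance_data.snd.snd.fst

@[fun_prop]
theorem rawMatrix : PolyTime fun I : {I : CVRP // P I} => I.1.tree.rawMatrix :=
  instance_data.snd.snd.snd

@[fun_prop]
theorem distHeight : PolyTime fun I : {I : CVRP // P I} => I.1.tree.distHeight := by
  unfold DepotTree.distHeight; fun_prop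

theorem lowerEnds (q R s : ℕ) : PolyTime fun I : {I : CVRP // P I} => I.1.lowerEnds q R s :=
  geomList _ _ (replicate_size (by fun_prop))

theorem group {P' : CVRP → Prop} {q R : ℕ} (h : ∀ I : {I : CVRP // P I}, ∀ a, P' (I.1.group q R a)) :
    PolyTime fun x : {I : CVRP // P I} × ℕ =>
      (⟨x.1.1.group q R x.2, h x.1 x.2⟩ : {I : CVRP // P' I}) := by
  have : PolyTime fun x : {I : CVRP // P I} × ℕ => (x.1.1.tree.root.val, x.1.1.capacity,
      _root_.maskDemands (_root_.rootDists x.1.1.tree.rawMatrix x.1.1.tree.root) (List.ofFn x.1.1.demand) (q ^ R)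
        (x.2, x.1.1.tree.distHeight * q ^ R), x.1.1.tree.rawMatrix) := by
    have h1 : PolyTime fun x : {I : CVRP // P I} × ℕ => x.1.1.tree.root.val := root.comp fst'
    have h2 : PolyTime fun x : {I : CVRP // P I} × ℕ => x.1.1.capacity := capacity.comp fst'
    have h3 : PolyTime fun x : {I : CVRP // P I} × ℕ => List.ofFn x.1.1.demand := demand.comp fst'
    have h4 : PolyTime fun x : {I : CVRP // P I} × ℕ => x.1.1.tree.rawMatrix := rawMatrix.comp fst'
    have h5 : PolyTime fun x : {I : CVRP // P I} × ℕ => x.1.1.tree.distHeight :=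
      distHeight.comp fst'
    fun_prop
  refine this.of_enc_eq fun x => ?_
  rw [← CVRP.ofFn_mask_demand]
  exact CVRP.encode_eq _

end PolyTime

/-- If every group of every shift is solved by an algorithm for bounded distances, then the cheapest
one of the resulting solutions is found in polynomial time. -/
theorem polyTime_cheapest {ver : Version} {P' : CVRP → Prop} {q P : ℕ}
    (h : ∀ I : {I : CVRP // I.IsInstance ver}, ∀ a, P' (I.1.group q P a))
    {plan : ∀ I : {I : CVRP // P' I}, I.1.tree.Plan}
    (hplan : PolyTime fun I => DepotTree.rawPlan (plan I)) (k : ℕ) :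
    PolyTime fun I : {I : CVRP // I.IsInstance ver} => DepotTree.rawPlan (CVRP.cheapest
      (fun s => I.1.shiftPlan q P (fun a => plan ⟨I.1.group q P a, h I a⟩) s ++
        I.1.tree.zeroPlan ver I.1.demand) k) := by
  have hc : ∀ s, PolyTime fun I : {I : CVRP // I.IsInstance ver} => DepotTree.rawPlan
      (I.1.shiftPlan q P (fun a => plan ⟨I.1.group q P a, h I a⟩) s ++
        I.1.tree.zeroPlan ver I.1.demand) := by
    intro s
    have h1 : PolyTime fun I : {I : CVRP // I.IsInstance ver} =>
        ((I.1.lowerEnds q P s).map fun a => DepotTree.rawPlan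
          (plan ⟨I.1.group q P a, h I a⟩)).flatten :=
      (PolyTime.map (hplan.comp (PolyTime.group h)) (PolyTime.lowerEnds q P s)).flatten
    have h2 : PolyTime fun I : {I : CVRP // I.IsInstance ver} =>
        zeroTours ver (rootPaths I.1.tree.rawMatrix I.1.tree.root)
          (rootDists I.1.tree.rawMatrix I.1.tree.root) (List.ofFn I.1.demand) := by fun_prop
    refine (h1.append h2).of_enc_eq fun I => ?_
    rw [← DepotTree.rawPlan_zeroPlan]
    congr 1
    simp [DepotTree.rawPlan, CVRP.shiftPlan, List.map_flatten]
    rfl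
  induction k with
  | zero => exact hc 0
  | succ k ih =>
    have hM : PolyTime fun I : {I : CVRP // I.IsInstance ver} => I.1.tree.rawMatrix := by fun_prop
    have hf := hM.planFrac (hc (k + 1))
    have hg := hM.planFrac ih
    exact (PolyTime.ite ((hf.fst.mul hg.snd).decide_le (hg.fst.mul hf.snd))
      (hc (k + 1)) ih).of_enc_eq fun I => congrArg enc (apply_ite DepotTree.rawPlan _ _ _)

theorem mainTheorem4 (ver : Version) (ε ρ : ℝ) (hε : 0 < ε) (hε' : ε ≤ 1 / 2) (hρ : 1 ≤ ρ)
    (hA : HasPolyTimeApprox ver ρ (CVRP.BoundedDistances ε)) :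
    HasPolyTimeApprox ver ((1 + 5 * ε) * ρ) (fun _ => True) := by
  obtain ⟨A, p, hA⟩ := hA
  obtain ⟨q, P, hq, hP, hqP, hloss⟩ := exists_base_shifts hε hε'
  choose plan time hrun htime hfeas hopt using
    fun I : {I : CVRP // I.IsInstance ver ∧ I.BoundedDistances ε} => hA I.1 I.2.1 I.2.2
  have hplan : PolyTime fun I => DepotTree.rawPlan (plan I) :=
    ⟨A, p, fun I => ⟨time I, by rw [← DepotTree.encodePlan_eq]; exact hrun I, htime I⟩⟩
  have hgroup : ∀ I : {I : CVRP // I.IsInstance ver}, ∀ a,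
      (I.1.group q P a).IsInstance ver ∧ (I.1.group q P a).BoundedDistances ε := fun I a =>
    ⟨I.2.mask _ _, I.1.boundedDistances_mask a (Nat.mul_pos DepotTree.distHeight_pos (by positivity))
      (by exact_mod_cast hqP)⟩
  obtain ⟨B, r, hB⟩ := polyTime_cheapest hgroup hplan (P - 1)
  refine ⟨B, r, fun I hI _ => ?_⟩
  obtain ⟨t, ht, ht'⟩ := hB ⟨I, hI⟩
  set c : ℕ → I.tree.Plan := fun s => I.shiftPlan q P
    (fun a => plan ⟨I.group q P a, hgroup ⟨I, hI⟩ a⟩) s ++ I.tree.zeroPlan ver I.demand with hc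
  obtain ⟨⟨s, hs, hcs⟩, hmin⟩ := CVRP.cheapest_spec c (P - 1)
  refine ⟨CVRP.cheapest c (P - 1), t, by rw [DepotTree.encodePlan_eq]; exact ht, ht', ?_,
    fun S hS => ?_⟩
  · rw [hcs]
    exact CVRP.feasible_shiftPlan hI hq (by omega) fun a => hfeas ⟨_, hgroup ⟨I, hI⟩ a⟩
  · have h1 := CVRP.sum_cost_shiftPlan_le hq (zero_le_one.trans hρ)
      (fun a => hopt ⟨_, hgroup ⟨I, hI⟩ a⟩) hS
    have h2 : (P : ℝ) * (CVRP.cheapest c (P - 1)).cost ≤ ∑ s ∈ Finset.range P,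
        ((I.shiftPlan q P (fun a => plan ⟨I.group q P a, hgroup ⟨I, hI⟩ a⟩) s).cost : ℝ) := by
      have hconst : (P : ℝ) * (CVRP.cheapest c (P - 1)).cost =
          ∑ s ∈ Finset.range P, ((CVRP.cheapest c (P - 1)).cost : ℝ) := by simp
      rw [hconst]
      refine Finset.sum_le_sum fun s hs => ?_
      have := hmin s (by rw [Finset.mem_range] at hs; omega)
      rw [hc, DepotTree.Plan.cost_append, DepotTree.cost_zeroPlan, add_zero] at this
      exact_mod_cast this
    have h3 : (0 : ℝ) ≤ S.cost := by positivity
    have h4 : (0 : ℝ) < P := by exact_mod_cast hP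
    refine le_of_mul_le_mul_left ?_ h4
    calc _ ≤ _ := h2.trans h1
      _ ≤ ρ * ((1 + 5 * ε) * P * S.cost) := by gcongr
      _ = _ := by ring
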